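/- Let $G$ be a group with finite symmetric generating set $\mathcal S$ and word metric $d_{\mathcal S}$, and let $P_0,\dots,P_{k-1}$ ($k\ge1$) be infinite subgroups of infinite index. Let $(g_i)_{i\ge0}$ be a sequence in $G$ with $g_0=\dots=g_{k-1}=e$ such that for each $r<k$ the map $a\mapsto g_{ak+r}P_r$ is a bijection from $\{0,1,2,\dots\}$ onto $G/P_r$. Write $(i)$ for the residue of $i$ mod $k$, so that the cosets are $g_iP_{(i)}$. The combinatorial horoball $\mathcal H(g_iP_{(i)})$ is the graph with vertex set $g_iP_{(i)}\times\{0,1,2,\dots\}$, with a horizontal edge between $(p,l)$ and $(q,l)$ whenever $0<d_{\mathcal S}(p,q)\le 2^l$ and a vertical edge between $(p,l)$ and $(p,l+1)$. Let $X$ be the augmented space, that is, the graph obtained from the Cayley graph $\Gamma$ of $(G,\mathcal S)$ by gluing on each $\mathcal H(g_iP_{(i)})$ along its level $0$, which is identified with $g_iP_{(i)}\subset\Gamma$; let $d$ be its path metric. Assume that $G$ is hyperbolic relative to $\{P_0,\dots,P_{k-1}\}$, i.e. that $X$ is Gromov hyperbolic, and let $\delta_0>0$ be such that all geodesic triangles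 of $X$ are $\delta_0$-thin: if $u\in[x,y]$ and $v\in[x,z]$ satisfy $d(x,u)=d(x,v)\le(y|z)_x$, then $d(u,v)\le\delta_0$. Here $(y|z)_x=\frac12(d(x,y)+d(x,z)-d(y,z))$. Let $\partial X$ be the Gromov boundary of $X$ (the Bowditch boundary of $G$). Fix $i\ge 0$, let $s_i\in\partial X$ be the parabolic point of $\mathcal H(g_iP_{(i)})$ (the end point of its vertical rays), and put $\hat P_i=\partial X\setminus\{s_i\}$ with the subspace topology. Let $X^i=\Gamma\cup\bigcup_{j\ne i}\mathcal H(g_jP_{(j)})$ (considered through its vertex set, with the metric restricted from $X$), fix an integer $N>\delta_0+1$, and let $e_i$ be the vertex of $\mathcal H(g_iP_{(i)})$ over $g_i$ at level $N$. Then: 1. For every $u\in\hat P_i$ there is a geodesic ray $l$ from $e_i$ with $l(\infty)=u$. For every vertex $x$ of $X^i$ there are a geodesic ray $l$ from $e_i$ with $l(\infty)\ne s_i$ and a time $t$ with $l(t)\in X^i$ and $d(x,l(t))\le2\delta_0$. Choose such a ray $l^u$ for every $u\in\hat P_i$. 2. For every $u\in\hat P_i$ the number $n_i(l^u)=\max\{n: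 l^u(n)\in g_iP_{(i)}\}$ exists. Hence $L_i\colon\hat P_i\to g_iP_{(i)}$, $L_i(u)=l^u(n_i(l^u))$, is well defined. 3. Call $E\subset\hat P_i\times\hat P_i$ controlled if $(L_i\times L_i)(E)$ is controlled for the bounded coarse structure of $(g_iP_{(i)},d_{\mathcal S})$. With this pullback coarse structure $\hat P_i$ is a proper coarse space: it is locally compact, second countable and Hausdorff, the diagonal has a controlled neighbourhood, bounded sets are relatively compact, and $\{(u,v)\}$ is controlled for all $u,v\in\hat P_i$. 4. $\hat P_i$ with this coarse structure is coarsely equivalent to $g_iP_{(i)}$. 5. For every choice, for each vertex $x$ of $X^i$, of a ray $l_x$ and a time $t_x$ as in 1, let $F_i\colon X^i\to\hat P_i$, $F_i(x)=l_x(\infty)$. Then for every Higson function $f\colon\hat P_i\to\mathbb C$, the pullback $f\circ F_i$ is a Higson function on $X^i$. Here a Higson function on a coarse space is a bounded continuous function $f$ such that for every controlled set $E$ and every $\epsilon>0$ there is a bounded set $B$ with $|f(y)-f(x)|<\epsilon$ for all $(x,y)\in E\setminus(B\times B)$. -/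

import Mathlib

open Set Topology
open scoped Pointwise

namespace RelHyp

/-! ### Coarse structures -/

/-- A coarse structure on `X`: a collection of subsets of `X × X` (the controlled sets) which
contains the diagonal and is closed under subsets, inverses, products and finite unions. -/
structure CoarseStructure (X : Type*) where
  controlled : Set (Set (X × X))
  diag : {x : X × X | x.1 = x.2} ∈ controlled
  subset : ∀ E ∈ controlled, ∀ E' ⊆ E, E' ∈ controlled
  inv : ∀ E ∈ controlled, {x : X × X | (x.2, x.1) ∈ E} ∈ controlled
  comp : ∀ E ∈ controlled, ∀ E' ∈ controlled,
    {x : X × X | ∃ y, (x.1, y) ∈ E ∧ (y, x.2) ∈ E'} ∈ controlled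
  union : ∀ E ∈ controlled, ∀ E' ∈ controlled, E ∪ E' ∈ controlled

namespace CoarseStructure

variable {X Y : Type*}

/-- `B` is bounded if `B × B` is controlled. -/
def IsBounded (𝓔 : CoarseStructure X) (B : Set X) : Prop :=
  B ×ˢ B ∈ 𝓔.controlled

/-- Two maps into a coarse space are close if the set of all `(f s, h s)` is controlled. -/
def Close {T : Type*} (𝓔 : CoarseStructure X) (f h : T → X) : Prop :=
  range (fun s => (f s, h s)) ∈ 𝓔.controlled

/-- A coarse map: inverse images of bounded sets are bounded, and images of controlled sets
are controlled. -/
structure IsCoarseMap (𝓔 : CoarseStructure X) (𝓕 : CoarseStructure Y) (f : X → Y) : Prop where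
  proper : ∀ B, 𝓕.IsBounded B → 𝓔.IsBounded (f ⁻¹' B)
  bornologous : ∀ E ∈ 𝓔.controlled, Prod.map f f '' E ∈ 𝓕.controlled

/-- Coarse equivalence of two coarse spaces. -/
def CoarselyEquivalent (𝓔 : CoarseStructure X) (𝓕 : CoarseStructure Y) : Prop :=
  ∃ (f : X → Y) (h : Y → X), IsCoarseMap 𝓔 𝓕 f ∧ IsCoarseMap 𝓕 𝓔 h ∧
    𝓔.Close (h ∘ f) id ∧ 𝓕.Close (f ∘ h) id

/-- The pullback coarse structure along `f`: `E` is controlled iff `(f × f)(E)` is. -/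
def pullback (𝓕 : CoarseStructure Y) (f : X → Y) : CoarseStructure X where
  controlled := {E | Prod.map f f '' E ∈ 𝓕.controlled}
  diag := by
    refine 𝓕.subset _ 𝓕.diag _ ?_
    rintro _ ⟨⟨a, b⟩, h, rfl⟩
    simp only [mem_ofPred_eq] at h
    simp [h]
  subset := fun E hE E' h => 𝓕.subset _ hE _ (image_mono h)
  inv := by
    intro E hE
    refine 𝓕.subset _ (𝓕.inv _ hE) _ ?_
    rintro _ ⟨⟨a, b⟩, h, rfl⟩
    exact ⟨(b, a), h, rfl⟩
  comp := by
    intro E hE E' hE'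
    refine 𝓕.subset _ (𝓕.comp _ hE _ hE') _ ?_
    rintro _ ⟨⟨a, b⟩, ⟨y, h, h'⟩, rfl⟩
    exact ⟨f y, ⟨(a, y), h, rfl⟩, ⟨(y, b), h', rfl⟩⟩
  union := by
    intro E hE E' hE'
    simp only [mem_ofPred_eq, image_union] at *
    exact 𝓕.union _ hE _ hE'

/-- The bounded coarse structure of the path metric of a graph, on its vertex set. -/
def ofGraph {V : Type*} (Γ : SimpleGraph V) : CoarseStructure V where
  controlled := {E | ∃ R : ℕ, ∀ x ∈ E, Γ.edist x.1 x.2 ≤ R}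
  diag := by
    refine ⟨0, ?_⟩
    rintro ⟨a, b⟩ h
    simp only [mem_ofPred_eq] at h
    simp [h]
  subset := fun E ⟨R, hR⟩ E' h => ⟨R, fun x hx => hR x (h hx)⟩
  inv := fun E ⟨R, hR⟩ => ⟨R, fun x hx => by
    rw [SimpleGraph.edist_comm]; exact hR _ hx⟩
  comp := by
    rintro E ⟨R, hR⟩ E' ⟨R', hR'⟩
    refine ⟨R + R', ?_⟩
    rintro x ⟨y, h, h'⟩
    push_cast
    exact (SimpleGraph.edist_triangle (v := y)).trans (add_le_add (hR _ h) (hR' _ h'))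
  union := by
    rintro E ⟨R, hR⟩ E' ⟨R', hR'⟩
    refine ⟨max R R', ?_⟩
    rintro x (h | h)
    · exact (hR x h).trans (by exact_mod_cast le_max_left R R')
    · exact (hR' x h).trans (by exact_mod_cast le_max_right R R')

/-- A proper coarse space: a locally compact second countable Hausdorff space with a coarse
structure such that the diagonal has a controlled neighbourhood, bounded sets are relatively
compact, and any two points form a controlled set. -/
structure IsProperSpace [TopologicalSpace X] (𝓔 : CoarseStructure X) : Prop where
  locallyCompact : LocallyCompactSpace X
  secondCountable : SecondCountableTopology X
  hausdorff : T2Space X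
  nhds_diag : ∃ E ∈ 𝓔.controlled, E ∈ 𝓝ˢ (diagonal X)
  relCompact : ∀ B, 𝓔.IsBounded B → IsCompact (closure B)
  connected : ∀ x y : X, {(x, y)} ∈ 𝓔.controlled

/-- A complex-valued Higson function: bounded, continuous and of vanishing variation. -/
structure IsHigson [TopologicalSpace X] (𝓔 : CoarseStructure X) (f : X → ℂ) : Prop where
  continuous : Continuous f
  bounded : ∃ M : ℝ, ∀ x, ‖f x‖ ≤ M
  vanishing : ∀ E ∈ 𝓔.controlled, ∀ ε : ℝ, 0 < ε → ∃ B, 𝓔.IsBounded B ∧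
    ∀ x y, (x, y) ∈ E \ (B ×ˢ B) → ‖f y - f x‖ < ε

end CoarseStructure

/-! ### Graphs as geodesic spaces

A connected graph is represented by its vertex set with the path metric; geodesics issuing from a
vertex are recorded by the sequence of vertices that they visit at integer times. -/

section Graph

variable {V : Type*} (Γ : SimpleGraph V)

/-- The Gromov product `(x|y)_o`. -/
noncomputable def gromovProduct (o x y : V) : ℝ :=
  ((Γ.dist x o : ℝ) + Γ.dist y o - Γ.dist x y) / 2

/-- `σ` restricted to `{0, …, d(x, y)}` is a geodesic from `x` to `y`. -/
def IsGeodesic (x y : V) (σ : ℕ → V) : Prop :=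
  σ 0 = x ∧ σ (Γ.dist x y) = y ∧
    ∀ m n, m + n ≤ Γ.dist x y → Γ.dist (σ m) (σ (m + n)) = n

/-- Every geodesic triangle is `δ`-thin: points on two sides issuing from a common corner `x`, at
the same distance `n ≤ (y|z)_x` from `x`, are at distance at most `δ`. -/
def ThinTriangles (δ : ℝ) : Prop :=
  ∀ (x y z : V) (σ τ : ℕ → V), IsGeodesic Γ x y σ → IsGeodesic Γ x z τ →
    ∀ n : ℕ, (n : ℝ) ≤ gromovProduct Γ x y z → (Γ.dist (σ n) (τ n) : ℝ) ≤ δ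

/-- Geodesic rays issuing from vertices. -/
def GeodesicRay : Type _ :=
  {l : ℕ → V // ∀ m n, Γ.dist (l m) (l (m + n)) = n}

/-- The topology of uniform convergence on compact sets (pointwise convergence of vertices). -/
instance : TopologicalSpace (GeodesicRay Γ) :=
  TopologicalSpace.induced Subtype.val (@Pi.topologicalSpace ℕ (fun _ => V) (fun _ => ⊥))

variable {Γ}

/-- The images of the two rays are at finite Hausdorff distance. -/
def Asymptotic (l l' : GeodesicRay Γ) : Prop :=
  ∃ R : ℕ, (∀ m, ∃ n, Γ.edist (l.1 m) (l'.1 n) ≤ R) ∧ (∀ n, ∃ m, Γ.edist (l.1 m) (l'.1 n) ≤ R)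

theorem asymptotic_equivalence : Equivalence (Asymptotic (Γ := Γ)) where
  refl l := ⟨0, fun m => ⟨m, by simp⟩, fun m => ⟨m, by simp⟩⟩
  symm := by
    rintro l l' ⟨R, h, h'⟩
    refine ⟨R, fun m => ?_, fun n => ?_⟩
    · obtain ⟨n, hn⟩ := h' m
      exact ⟨n, by rwa [SimpleGraph.edist_comm]⟩
    · obtain ⟨m, hm⟩ := h n
      exact ⟨m, by rwa [SimpleGraph.edist_comm]⟩
  trans := by
    rintro l l' l'' ⟨R, h, h'⟩ ⟨Q, k, k'⟩
    refine ⟨R + Q, fun m => ?_, fun n => ?_⟩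
    · obtain ⟨n, hn⟩ := h m
      obtain ⟨p, hp⟩ := k n
      refine ⟨p, ?_⟩
      push_cast
      exact (SimpleGraph.edist_triangle (v := l'.1 n)).trans (add_le_add hn hp)
    · obtain ⟨p, hp⟩ := k' n
      obtain ⟨m, hm⟩ := h' p
      refine ⟨m, ?_⟩
      push_cast
      exact (SimpleGraph.edist_triangle (v := l'.1 p)).trans (add_le_add hm hp)

variable (Γ)

/-- Geodesic rays up to finite Hausdorff distance. -/
def rayEquiv : Setoid (GeodesicRay Γ) := ⟨Asymptotic, asymptotic_equivalence⟩

/-- The Gromov boundary. -/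
def GromovBoundary : Type _ := Quotient (rayEquiv Γ)

variable {Γ} in
/-- The end point `l(∞)` of a geodesic ray. -/
def GeodesicRay.endpoint (l : GeodesicRay Γ) : GromovBoundary Γ := Quotient.mk (rayEquiv Γ) l

/-- The boundary carries the quotient topology from the space of geodesic rays. -/
instance : TopologicalSpace (GromovBoundary Γ) :=
  TopologicalSpace.coinduced GeodesicRay.endpoint inferInstance

end Graph

/-! ### The augmented space -/

section Augmented

/-- The combinatorial horoball based on a set `Q` with metric `d`. -/
def combinatorialHoroball {Q : Type*} (d : Q → Q → ℕ) : SimpleGraph (Q × ℕ) :=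
  SimpleGraph.fromRel fun x y =>
    (x.2 = y.2 ∧ 0 < d x.1 y.1 ∧ d x.1 y.1 ≤ 2 ^ x.2) ∨ (x.1 = y.1 ∧ y.2 = x.2 + 1)

variable {G : Type*}

/-- The vertices of the space obtained from the Cayley graph of `G` by gluing, for each `i`, the
combinatorial horoball based on `C i ⊆ G` along its level `0`: the elements of `G`, and the points
`horo i p l`, which stand for the vertex of the `i`-th horoball over `p` at level `l + 1`. -/
inductive AugVertex (C : ℕ → Set G) : Type _
  | base (x : G) : AugVertex C
  | horo (i : ℕ) (p : C i) (l : ℕ) : AugVertex C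

instance (C : ℕ → Set G) : TopologicalSpace (AugVertex C) := ⊥

/-- The inclusion of the vertex set of the `i`-th horoball; level `0` is identified with
`C i ⊆ G`. -/
def AugVertex.pt {C : ℕ → Set G} (i : ℕ) : C i × ℕ → AugVertex C
  | (p, 0) => .base p
  | (p, l + 1) => .horo i p l

/-- The level of a vertex. -/
def AugVertex.level {C : ℕ → Set G} : AugVertex C → ℕ
  | .base _ => 0
  | .horo _ _ l => l + 1

theorem AugVertex.level_pt {C : ℕ → Set G} (i : ℕ) (x : C i × ℕ) :
    (AugVertex.pt i x).level = x.2 := by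
  rcases x with ⟨p, _ | l⟩ <;> rfl

variable [Group G]

/-- The word metric. -/
noncomputable def wordDist (S : Set G) (x y : G) : ℕ := (SimpleGraph.mulCayley S).dist x y

/-- The Cayley graph with combinatorial horoballs glued on; each `C i` carries the restriction of
the word metric. -/
noncomputable def augmentedSpace (S : Set G) (C : ℕ → Set G) : SimpleGraph (AugVertex C) :=
  (SimpleGraph.mulCayley S).map AugVertex.base ⊔
    ⨆ i, (combinatorialHoroball fun p q : C i => wordDist S p q).map (AugVertex.pt i)

theorem level_le_of_adj {S : Set G} {C : ℕ → Set G} {x y : AugVertex C}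
    (h : (augmentedSpace S C).Adj x y) : y.level ≤ x.level + 1 := by
  simp only [augmentedSpace, SimpleGraph.sup_adj, SimpleGraph.iSup_adj] at h
  rcases h with ⟨-, a, b, -, rfl, rfl⟩ | ⟨i, -, a, b, h, rfl, rfl⟩
  · simp [AugVertex.level]
  · rw [AugVertex.level_pt, AugVertex.level_pt]
    rw [combinatorialHoroball, SimpleGraph.fromRel_adj] at h
    omega

theorem level_le_of_walk {S : Set G} {C : ℕ → Set G} {x y : AugVertex C}
    (w : (augmentedSpace S C).Walk x y) : y.level ≤ x.level + w.length := by
  induction w with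
  | nil => simp
  | cons h w ih =>
    have := level_le_of_adj h
    simp only [SimpleGraph.Walk.length_cons]
    omega

theorem vertical_adj (S : Set G) {C : ℕ → Set G} (i : ℕ) (p : C i) (n : ℕ) :
    (augmentedSpace S C).Adj (AugVertex.pt i (p, n)) (AugVertex.pt i (p, n + 1)) := by
  simp only [augmentedSpace, SimpleGraph.sup_adj, SimpleGraph.iSup_adj]
  refine Or.inr ⟨i, fun h => ?_, (p, n), (p, n + 1), ?_, rfl, rfl⟩
  · have := congrArg AugVertex.level h
    rw [AugVertex.level_pt, AugVertex.level_pt] at this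
    simp at this
  · rw [combinatorialHoroball, SimpleGraph.fromRel_adj]
    exact ⟨by simp, Or.inl (Or.inr ⟨rfl, rfl⟩)⟩

theorem exists_vertical_walk (S : Set G) {C : ℕ → Set G} (i : ℕ) (p : C i) (m n : ℕ) :
    ∃ w : (augmentedSpace S C).Walk (AugVertex.pt i (p, m)) (AugVertex.pt i (p, m + n)),
      w.length = n := by
  induction n with
  | zero => exact ⟨.nil, rfl⟩
  | succ n ih =>
    obtain ⟨w, hw⟩ := ih
    exact ⟨w.append (.cons (vertical_adj S i p (m + n)) .nil), by
      simp [SimpleGraph.Walk.length_append, hw]⟩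

/-- The vertical ray of the `i`-th horoball over `p`. -/
noncomputable def verticalRay (S : Set G) {C : ℕ → Set G} (i : ℕ) (p : C i) :
    GeodesicRay (augmentedSpace S C) :=
  ⟨fun n => AugVertex.pt i (p, n), fun m n => by
    obtain ⟨w, hw⟩ := exists_vertical_walk S i p m n
    obtain ⟨w', hw'⟩ := w.reachable.exists_walk_length_eq_dist
    have h1 := SimpleGraph.dist_le w
    have h2 := level_le_of_walk w'
    rw [AugVertex.level_pt, AugVertex.level_pt] at h2
    change (augmentedSpace S C).dist (AugVertex.pt i (p, m)) (AugVertex.pt i (p, m + n)) = n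
    dsimp only at h2
    omega⟩

end Augmented

/-! ### Relatively hyperbolic groups -/

section RelativelyHyperbolic

variable {G : Type*} [Group G] {k : ℕ} [NeZero k] (P : Fin k → Subgroup G) (g : ℕ → G)

/-- An order of the cosets of the subgroups `P 0, …, P (k - 1)`: the sequence starts with `k`
times the identity, and for each `r` the cosets of `P r` are enumerated without repetition by the
indices congruent to `r` modulo `k`. -/
structure IsCosetOrder : Prop where
  one : ∀ i < k, g i = 1
  bijective : ∀ r : Fin k, Function.Bijective fun a : ℕ => (g (a * k + r) : G ⧸ P r)

/-- The `i`-th coset `g_i P_(i)`, where `(i)` is the residue of `i` modulo `k`. -/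
def coset (i : ℕ) : Set G := g i • (P (Fin.ofNat k i) : Set G)

/-- The representative `g_i` as an element of the `i`-th coset. -/
def cosetRep (i : ℕ) : coset P g i := ⟨g i, 1, (P (Fin.ofNat k i)).one_mem, by simp⟩

variable (S : Set G)

/-- The augmented space `X(G, P, S)`. -/
noncomputable abbrev augGraph : SimpleGraph (AugVertex (coset P g)) :=
  augmentedSpace S (coset P g)

/-- The parabolic point `s_i`: the point at infinity of the `i`-th horoball. -/
noncomputable def parabolicPoint (i : ℕ) : GromovBoundary (augGraph P g S) :=
  (verticalRay S i (cosetRep P g i)).endpoint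

/-- The complement of the parabolic point `s_i` in the boundary, with the subspace topology. -/
abbrev PuncturedBoundary (i : ℕ) : Type _ :=
  {u : GromovBoundary (augGraph P g S) // u ≠ parabolicPoint P g S i}

/-- The base point `e_i`, at level `N` of the `i`-th horoball over `g_i`. -/
def basePoint (i N : ℕ) : AugVertex (coset P g) := AugVertex.pt i (cosetRep P g i, N)

/-- The vertex set of `X^i`: everything except the vertices of the `i`-th horoball at positive
level. -/
def outerVertices (i : ℕ) : Set (AugVertex (coset P g)) :=
  {x | ∀ p l, x ≠ AugVertex.horo i p l}

/-- The bounded coarse structure of the coset `g_i P_(i)` with the restricted word metric. -/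
def cosetCoarse (i : ℕ) : CoarseStructure (coset P g i) :=
  (CoarseStructure.ofGraph (SimpleGraph.mulCayley S)).pullback Subtype.val

/-- The bounded coarse structure of (the vertex set of) `X^i` with the metric restricted from the
augmented space. -/
noncomputable def outerCoarse (i : ℕ) : CoarseStructure (outerVertices P g i) :=
  (CoarseStructure.ofGraph (augGraph P g S)).pullback Subtype.val

/-- The times at which `l` is in the coset `g_i P_(i)`. -/
def visitTimes (i : ℕ) (l : ℕ → AugVertex (coset P g)) : Set ℕ :=
  {n | ∃ p : coset P g i, l n = AugVertex.base (p : G)}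

/-- The last time `n_i(l)` at which `l` is in the coset `g_i P_(i)`. -/
noncomputable def lastTime (i : ℕ) (l : ℕ → AugVertex (coset P g)) : ℕ :=
  sSup (visitTimes P g i l)

open Classical in
/-- The point `l(n_i(l))` of the coset `g_i P_(i)` (and `g_i` if there is no such point). -/
noncomputable def lastPoint (i : ℕ) (l : ℕ → AugVertex (coset P g)) : coset P g i :=
  if h : ∃ p : coset P g i, l (lastTime P g i l) = AugVertex.base (p : G) then h.choose
  else cosetRep P g i

/-- The geodesic rays `l^u` from `e_i` to `u`. -/
def RayTo (i N : ℕ) (u : GromovBoundary (augGraph P g S)) : Type _ :=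
  {l : GeodesicRay (augGraph P g S) // l.1 0 = basePoint P g i N ∧ l.endpoint = u}

/-- The geodesic rays `l_x`, with a time `t_x`: rays from `e_i` not ending at `s_i` which at some
time are in `X^i` at distance at most `2δ` from `x`. -/
structure RayNear (i N : ℕ) (δ : ℝ) (x : AugVertex (coset P g)) where
  ray : GeodesicRay (augGraph P g S)
  time : ℕ
  start : ray.1 0 = basePoint P g i N
  endpoint_ne : ray.endpoint ≠ parabolicPoint P g S i
  outer : ray.1 time ∈ outerVertices P g i
  near : ((augGraph P g S).dist x (ray.1 time) : ℝ) ≤ 2 * δ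

variable {P g S}

/-- The map `L_i` sending `u` to the last point of `l^u` in the coset `g_i P_(i)`. -/
noncomputable def mapL {i N : ℕ} (lu : ∀ u : PuncturedBoundary P g S i, RayTo P g S i N u.1) :
    PuncturedBoundary P g S i → coset P g i :=
  fun u => lastPoint P g i (lu u).1.1

/-- The map `F_i` sending `x` to the end point of `l_x`. -/
noncomputable def mapF {i N : ℕ} {δ : ℝ} (lx : ∀ x : outerVertices P g i, RayNear P g S i N δ x.1) :
    outerVertices P g i → PuncturedBoundary P g S i :=
  fun x => ⟨(lx x).ray.endpoint, (lx x).endpoint_ne⟩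

/-- The pullback coarse structure on the complement of `s_i` along `L_i`. -/
noncomputable def puncturedCoarse {i N : ℕ}
    (lu : ∀ u : PuncturedBoundary P g S i, RayTo P g S i N u.1) :
    CoarseStructure (PuncturedBoundary P g S i) :=
  (cosetCoarse P g S i).pullback (mapL lu)

end RelativelyHyperbolic

end RelHyp

open RelHyp

/-! Write `D` for the integer part of the thinness constant, so that `D + 2 ≤ N`. Thin triangles in
a locally finite graph give the standard theory. Geodesics subconverge to rays, asymptotic rays from
`e_i` stay `D`-close, and the boundary is compact, Hausdorff and second countable.

The horoball enters through its depth function, which is 1-Lipschitz and vanishes on `X^i`. A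
geodesic from `e_i` to a point near the rim (level `0`) is compared with one to a very high point of
the horoball. It follows that its depth is large except near its end (`depth_of_between`). So a ray
that does not end at `s_i` leaves the horoball once and for all through a last rim point. If it is
near `X^i` at a late time, it leaves soon after (`ExitsAt.le_add`), and fellow travelling rays leave
at nearby rim points (`ExitsAt.dist_le`). A distance `n` in `X` bounds the word distance by `2 ^ n`,
so these estimates pass to the coset.

For the rays near `x ∈ X^i`, go up the vertical line through `x`, and in the other direction down to
the rim, across an edge to a disjoint coset and up its horoball. For large height this is a side of
a triangle with third corner `e_i`. Thinness puts `x` near another side, and `exists_between_outer`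
finds a point of `X^i` there within `2D` of `x`. A limit of such sides is the required ray
(`exists_ray_near`).

A neighbourhood of a point of the punctured boundary consists of points whose rays fellow travel
past the exit time, so their last points are close. A bounded set has bounded exit times, so it
avoids a neighbourhood of `s_i`. Applied to rim points, the rays near `x` make `L_i` coarsely
surjective. For the Higson property take nearby `x`, `y` far from `e_i`. The last points of their
rays are at bounded distance, so the variation of `f` is small unless both end points lie in a fixed
bounded set. In that case the rays fellow travel for long, and uniform continuity on the compact
closure applies. -/

namespace RelHyp

/-! ### Geodesics and thin triangles in a graph -/

section Geodesics

variable {V : Type*} {Γ : SimpleGraph V}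

/-- `u` lies on a geodesic from `x` to `y`. -/
def Between (Γ : SimpleGraph V) (x u y : V) : Prop :=
  Γ.dist x u + Γ.dist u y = Γ.dist x y

theorem Between.symm {x u y : V} (h : Between Γ x u y) : Between Γ y u x := by
  unfold Between at *
  rw [Γ.dist_comm (u := y), Γ.dist_comm (u := u) (v := x), Γ.dist_comm (u := y)]
  omega

theorem between_left (x y : V) : Between Γ x x y := by simp [Between]

theorem Between.trans (hc : Γ.Connected) {x u v y : V} (h : Between Γ x u y)
    (h' : Between Γ u v y) : Between Γ x v y := by
  have h1 := hc.dist_triangle (u := x) (v := u) (w := v)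
  have h2 := hc.dist_triangle (u := x) (v := v) (w := y)
  unfold Between at *
  omega

theorem Between.trans_left (hc : Γ.Connected) {x u v y : V} (h : Between Γ x u y)
    (h' : Between Γ x v u) : Between Γ x v y := by
  have h1 := hc.dist_triangle (u := v) (v := u) (w := y)
  have h2 := hc.dist_triangle (u := x) (v := v) (w := y)
  unfold Between at *
  omega

theorem dist_le_of_dist_succ_le_one (hc : Γ.Connected) {σ : ℕ → V} {m n : ℕ}
    (h : ∀ t, m ≤ t → t < m + n → Γ.dist (σ t) (σ (t + 1)) ≤ 1) : Γ.dist (σ m) (σ (m + n)) ≤ n := by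
  induction n with
  | zero => simp
  | succ n ih =>
    have h1 := ih fun t ht ht' => h t ht (by omega)
    have h2 := h (m + n) (by omega) (by omega)
    have h3 := hc.dist_triangle (u := σ m) (v := σ (m + n)) (w := σ (m + n + 1))
    rw [← add_assoc]
    omega

/-- The three segments cut out by `m` and `m + n` have total length at most `d(x, y)`, so the
triangle inequality leaves no slack in any of them. -/
theorem isGeodesic_of_dist_succ_le_one (hc : Γ.Connected) {x y : V} {σ : ℕ → V} (h0 : σ 0 = x)
    (h1 : σ (Γ.dist x y) = y) (h : ∀ t < Γ.dist x y, Γ.dist (σ t) (σ (t + 1)) ≤ 1) :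
    IsGeodesic Γ x y σ := by
  refine ⟨h0, h1, fun m n hmn => ?_⟩
  have a := dist_le_of_dist_succ_le_one hc (σ := σ) (m := 0) (n := m) fun t _ ht => h t (by omega)
  have b := dist_le_of_dist_succ_le_one hc (σ := σ) (m := m) (n := n) fun t _ ht => h t (by omega)
  have c := dist_le_of_dist_succ_le_one hc (σ := σ) (m := m + n) (n := Γ.dist x y - (m + n))
    fun t _ ht => h t (by omega)
  rw [show m + n + (Γ.dist x y - (m + n)) = Γ.dist x y by omega, h1] at c
  rw [zero_add, h0] at a
  have d := hc.dist_triangle (u := x) (v := σ m) (w := y)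
  have e := hc.dist_triangle (u := σ m) (v := σ (m + n)) (w := y)
  omega

theorem dist_le_one_of_adj {x y : V} (h : Γ.Adj x y) : Γ.dist x y ≤ 1 :=
  (SimpleGraph.dist_eq_one_iff_adj.2 h).le

theorem exists_isGeodesic (hc : Γ.Connected) (x y : V) : ∃ σ, IsGeodesic Γ x y σ := by
  obtain ⟨w, hw⟩ := hc.exists_walk_length_eq_dist x y
  refine ⟨w.getVert, isGeodesic_of_dist_succ_le_one hc (by simp) (by rw [← hw]; simp) ?_⟩
  intro t ht
  exact dist_le_one_of_adj (w.adj_getVert_succ (by omega))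

theorem Between.exists_isGeodesic (hc : Γ.Connected) {x u y : V} (h : Between Γ x u y) :
    ∃ σ, IsGeodesic Γ x y σ ∧ σ (Γ.dist x u) = u := by
  obtain ⟨σ, hσ0, hσ1, hσ⟩ := RelHyp.exists_isGeodesic hc x u
  obtain ⟨τ, hτ0, hτ1, hτ⟩ := RelHyp.exists_isGeodesic hc u y
  unfold Between at h
  refine ⟨fun t => if t ≤ Γ.dist x u then σ t else τ (t - Γ.dist x u),
    isGeodesic_of_dist_succ_le_one hc (by simp [hσ0]) ?_ ?_, by simp [hσ1]⟩
  · split_ifs with h1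
    · have h2 : Γ.dist u y = 0 := by omega
      rw [h2, hτ0] at hτ1
      rw [← h, h2, add_zero, hσ1, hτ1]
    · rw [← h, Nat.add_sub_cancel_left, hτ1]
  · intro t ht
    rcases lt_trichotomy t (Γ.dist x u) with h1 | h1 | h1
    · rw [if_pos (by omega), if_pos (by omega)]
      exact (hσ t 1 (by omega)).le
    · rw [if_pos (by omega), if_neg (by omega), h1, hσ1]
      have := hτ 0 1 (by omega)
      rw [hτ0] at this
      rw [show Γ.dist x u + 1 - Γ.dist x u = 0 + 1 by omega]
      exact this.le
    · rw [if_neg (by omega), if_neg (by omega),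
        show t + 1 - Γ.dist x u = t - Γ.dist x u + 1 by omega]
      exact (hτ _ 1 (by omega)).le

theorem IsGeodesic.dist_start {x y : V} {σ : ℕ → V} (h : IsGeodesic Γ x y σ) {t : ℕ}
    (ht : t ≤ Γ.dist x y) : Γ.dist x (σ t) = t := by
  have := h.2.2 0 t (by omega)
  rwa [zero_add, h.1] at this

theorem IsGeodesic.between {x y : V} {σ : ℕ → V} (h : IsGeodesic Γ x y σ) {t : ℕ}
    (ht : t ≤ Γ.dist x y) : Between Γ x (σ t) y := by
  have h1 := h.2.2 t (Γ.dist x y - t) (by omega)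
  rw [show t + (Γ.dist x y - t) = Γ.dist x y by omega, h.2.1] at h1
  rw [Between, h.dist_start ht, h1]
  omega

theorem exists_between (hc : Γ.Connected) {x y : V} {n : ℕ} (h : n ≤ Γ.dist x y) :
    ∃ u, Between Γ x u y ∧ Γ.dist x u = n := by
  obtain ⟨σ, hσ⟩ := exists_isGeodesic hc x y
  exact ⟨σ n, hσ.between h, hσ.dist_start h⟩

theorem dist_lt_of_between (hc : Γ.Connected) {x u y : V} (h : Between Γ x u y) (hne : x ≠ u) :
    Γ.dist u y < Γ.dist x y := by
  have := hc.pos_dist_of_ne hne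
  unfold Between at h
  omega

/-- Thin triangles in terms of points lying on the sides, with an integral constant. -/
def Thin (Γ : SimpleGraph V) (D : ℕ) : Prop :=
  ∀ x y z u v : V, Between Γ x u y → Between Γ x v z → Γ.dist x u = Γ.dist x v →
    2 * Γ.dist x u + Γ.dist y z ≤ Γ.dist x y + Γ.dist x z → Γ.dist u v ≤ D

/-- Distances are integers, so the constant can be rounded down. Every point between two vertices
lies on some geodesic, so naming the geodesic is unnecessary. -/
theorem ThinTriangles.thin (hc : Γ.Connected) {δ : ℝ} (h : ThinTriangles Γ δ) :
    Thin Γ ⌊δ⌋₊ := by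
  intro x y z u v hu hv huv hp
  obtain ⟨σ, hσ, hσu⟩ := hu.exists_isGeodesic hc
  obtain ⟨τ, hτ, hτv⟩ := hv.exists_isGeodesic hc
  have := h x y z σ τ hσ hτ (Γ.dist x u) (by
    rw [gromovProduct, Γ.dist_comm (u := y), Γ.dist_comm (u := z), le_div_iff₀ (by norm_num)]
    have : (2 * Γ.dist x u + Γ.dist y z : ℝ) ≤ Γ.dist x y + Γ.dist x z := by exact_mod_cast hp
    linarith)
  rw [hσu, huv, hτv] at this
  exact Nat.le_floor this

end Geodesics

/-! ### Fellow travelling of geodesic rays -/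

section Rays

variable {V : Type*} {Γ : SimpleGraph V}

theorem GeodesicRay.dist_eq (l : GeodesicRay Γ) {m n : ℕ} (h : m ≤ n) :
    Γ.dist (l.1 m) (l.1 n) = n - m := by
  obtain ⟨k, rfl⟩ := Nat.exists_eq_add_of_le h
  rw [l.2]
  omega

theorem GeodesicRay.dist_zero (l : GeodesicRay Γ) (n : ℕ) : Γ.dist (l.1 0) (l.1 n) = n := by
  simp [l.dist_eq n.zero_le]

theorem GeodesicRay.between (l : GeodesicRay Γ) {m n : ℕ} (h : m ≤ n) :
    Between Γ (l.1 0) (l.1 m) (l.1 n) := by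
  rw [Between, l.dist_zero, l.dist_zero, l.dist_eq h]
  omega

theorem asymptotic_of_dist_le (hc : Γ.Connected) {l l' : GeodesicRay Γ} {C : ℕ}
    (h : ∀ t, Γ.dist (l.1 t) (l'.1 t) ≤ C) : Asymptotic l l' := by
  have h' : ∀ t, Γ.edist (l.1 t) (l'.1 t) ≤ C := fun t => by
    rw [← (hc _ _).coe_dist_eq_edist]
    exact_mod_cast h t
  exact ⟨C, fun m => ⟨m, h' m⟩, fun m => ⟨m, h' m⟩⟩

/-- A point between `e` and a point of a ray is close to the point of the ray at the same time. -/
theorem dist_le_of_between_ray (hc : Γ.Connected) {D : ℕ} (hD : Thin Γ D) (l : GeodesicRay Γ)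
    {e w : V} {n : ℕ} (hw : Between Γ e w (l.1 n)) :
    Γ.dist w (l.1 (Γ.dist e w)) ≤ D + 3 * Γ.dist e (l.1 0) := by
  set t := Γ.dist e w
  have h1 := hc.dist_triangle (u := e) (v := l.1 0) (w := l.1 n)
  have h2 := hc.dist_triangle (u := l.1 0) (v := e) (w := l.1 n)
  have h3 := l.dist_zero n
  have h4 := Γ.dist_comm (u := l.1 0) (v := e)
  have hw' := hw
  unfold Between at hw
  rcases le_total t (Γ.dist e (l.1 0)) with h | h
  · have h5 := hc.dist_triangle (u := w) (v := e) (w := l.1 t)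
    have h6 := hc.dist_triangle (u := e) (v := l.1 0) (w := l.1 t)
    have h7 := l.dist_zero t
    have h8 := Γ.dist_comm (u := w) (v := e)
    omega
  -- `l s` and `w` are equally far from the corner `l n`. The times `s` and `t` differ by `|n - d(e,
  -- l n)|`, which is at most `d(e, l 0)`.
  · obtain ⟨s, hs⟩ : ∃ s, s + Γ.dist e (l.1 n) = t + n :=
      ⟨t + n - Γ.dist e (l.1 n), by omega⟩
    have h9 : s ≤ n := by omega
    have h5 := hD (l.1 n) e (l.1 0) w (l.1 s) hw'.symm (l.between h9).symm (by
      rw [Γ.dist_comm (v := w), Γ.dist_comm (v := l.1 s), l.dist_eq h9]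
      omega) (by
      rw [Γ.dist_comm (v := w), Γ.dist_comm (v := e), Γ.dist_comm (u := l.1 n) (v := l.1 0)]
      omega)
    have h6 := hc.dist_triangle (u := w) (v := l.1 s) (w := l.1 t)
    have h7 : Γ.dist (l.1 s) (l.1 t) ≤ Γ.dist e (l.1 0) := by
      rcases le_total s t with h | h
      · rw [l.dist_eq h]; omega
      · rw [Γ.dist_comm, l.dist_eq h]; omega
    omega

theorem Asymptotic.exists_dist_le (hc : Γ.Connected) {l l' : GeodesicRay Γ} (h : Asymptotic l l') :
    ∃ R : ℕ, ∀ m, ∃ n, Γ.dist (l.1 m) (l'.1 n) ≤ R := by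
  obtain ⟨R, h, -⟩ := h
  refine ⟨R, fun m => ?_⟩
  obtain ⟨n, hn⟩ := h m
  rw [← (hc _ _).coe_dist_eq_edist] at hn
  exact ⟨n, by exact_mod_cast hn⟩

/-- The hypothesis bounds `t` by the Gromov product of `l m` and `l' n` at the common origin, which
also forces `t ≤ m` and `t ≤ n`. -/
theorem dist_le_of_ray (hc : Γ.Connected) {D : ℕ} (hD : Thin Γ D) {l l' : GeodesicRay Γ}
    (h0 : l.1 0 = l'.1 0) {m n t : ℕ} (h : 2 * t + Γ.dist (l.1 m) (l'.1 n) ≤ m + n) :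
    Γ.dist (l.1 t) (l'.1 t) ≤ D := by
  have h1 := l.dist_zero
  have h2 := l'.dist_zero
  rw [← h0] at h2
  have h3 := hc.dist_triangle (u := l.1 0) (v := l.1 m) (w := l'.1 n)
  have h4 := hc.dist_triangle (u := l.1 0) (v := l'.1 n) (w := l.1 m)
  rw [Γ.dist_comm (u := l'.1 n)] at h4
  have h5 := h1 m
  have h6 := h2 n
  have h7 := l'.between (m := t) (n := n) (by omega)
  rw [← h0] at h7
  exact hD (l.1 0) (l.1 m) (l'.1 n) _ _ (l.between (by omega)) h7 (by rw [h1, h2])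
    (by rw [h1]; omega)

/-- Asymptotic rays with the same origin are uniformly close. -/
theorem Asymptotic.dist_le (hc : Γ.Connected) {D : ℕ} (hD : Thin Γ D) {l l' : GeodesicRay Γ}
    (h : Asymptotic l l') (h0 : l.1 0 = l'.1 0) (t : ℕ) : Γ.dist (l.1 t) (l'.1 t) ≤ D := by
  obtain ⟨R, hR⟩ := h.exists_dist_le hc
  obtain ⟨n, hn⟩ := hR (t + R)
  have h3 := hc.dist_triangle (u := l.1 0) (v := l'.1 n) (w := l.1 (t + R))
  rw [Γ.dist_comm (u := l'.1 n), l.dist_zero, h0, l'.dist_zero] at h3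
  exact dist_le_of_ray hc hD h0 (m := t + R) (n := n) (by omega)

/-- Asymptotic rays are uniformly close, in terms of the distance of their origins. -/
theorem Asymptotic.dist_le' (hc : Γ.Connected) {D : ℕ} (hD : Thin Γ D) {l l' : GeodesicRay Γ}
    (h : Asymptotic l l') (t : ℕ) :
    Γ.dist (l.1 t) (l'.1 t) ≤ 2 * D + 3 * Γ.dist (l'.1 0) (l.1 0) := by
  obtain ⟨R, hR⟩ := h.exists_dist_le hc
  set c := Γ.dist (l'.1 0) (l.1 0)
  obtain ⟨n, hn⟩ := hR (t + R + c)
  set m := t + R + c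
  have h1 := hc.dist_triangle (u := l.1 0) (v := l'.1 0) (w := l.1 m)
  rw [l.dist_zero, Γ.dist_comm (u := l.1 0)] at h1
  have h2 := hc.dist_triangle (u := l'.1 0) (v := l'.1 n) (w := l.1 m)
  rw [l'.dist_zero, Γ.dist_comm (u := l'.1 n)] at h2
  -- The point `w` on a geodesic from the origin of `l'` to `l m` mediates: it is close to `l t` by
  -- the previous comparison, and to `l' t` by thinness at the origin of `l'`.
  obtain ⟨w, hw, hwt⟩ := exists_between hc (x := l'.1 0) (y := l.1 m) (n := t) (by omega)
  have h3 := dist_le_of_between_ray hc hD l hw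
  rw [hwt] at h3
  have h4 := hD _ _ _ w (l'.1 t) hw (l'.between (n := n) (by omega)) (by rw [hwt, l'.dist_zero])
    (by rw [hwt, l'.dist_zero]; omega)
  have h5 := hc.dist_triangle (u := l.1 t) (v := w) (w := l'.1 t)
  rw [Γ.dist_comm (u := l.1 t) (v := w)] at h5
  omega

theorem endpoint_eq_iff {l l' : GeodesicRay Γ} : l.endpoint = l'.endpoint ↔ Asymptotic l l' :=
  Quotient.eq (r := rayEquiv Γ)

theorem exists_endpoint (u : GromovBoundary Γ) : ∃ l : GeodesicRay Γ, l.endpoint = u :=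
  Quotient.exists_rep u

end Rays

/-! ### Limits of geodesics along ultrafilters -/

section Limits

open Filter

variable {V : Type*} {Γ : SimpleGraph V}

theorem exists_eventually_eq {ι : Type*} (U : Ultrafilter ι) {σ : ι → V} {B : Set V}
    (hB : B.Finite) (h : ∀ᶠ i in U, σ i ∈ B) : ∃ v, ∀ᶠ i in U, σ i = v := by
  have : (⋃ v ∈ B, {i | σ i = v}) ∈ U := by
    filter_upwards [h] with i hi
    simpa using hi
  rw [Ultrafilter.finite_biUnion_mem_iff hB] at this
  obtain ⟨v, -, hv⟩ := this
  exact ⟨v, hv⟩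

/-- Pointwise limit of sequences of vertices along an ultrafilter. -/
theorem exists_limit_ray {ι : Type*} (U : Ultrafilter ι) (σ : ι → ℕ → V)
    (hB : ∀ t, ∃ B : Set V, B.Finite ∧ ∀ᶠ i in U, σ i t ∈ B)
    (hσ : ∀ m n, ∀ᶠ i in U, Γ.dist (σ i m) (σ i (m + n)) = n) :
    ∃ l : GeodesicRay Γ, ∀ t, ∀ᶠ i in U, σ i t = l.1 t := by
  choose B hB hσB using hB
  choose l hl using fun t => exists_eventually_eq U (hB t) (hσB t)
  refine ⟨⟨l, fun m n => ?_⟩, hl⟩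
  obtain ⟨i, h1, h2, h3⟩ := ((hl m).and ((hl (m + n)).and (hσ m n))).exists
  rwa [h1, h2] at h3

/-- Every ray can be replaced by an asymptotic ray with a given origin `e`, passing through a point
which is between `e` and arbitrarily far points of the ray. -/
theorem exists_ray_asymptotic (hc : Γ.Connected) {D : ℕ} (hD : Thin Γ D)
    (hfin : ∀ x n, {y | Γ.dist x y ≤ n}.Finite) (ρ : GeodesicRay Γ) (e w : V)
    (hw : ∃ᶠ n in atTop, Between Γ e w (ρ.1 n)) :
    ∃ l : GeodesicRay Γ, l.1 0 = e ∧ l.1 (Γ.dist e w) = w ∧ Asymptotic l ρ := by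
  have : (atTop ⊓ 𝓟 {n | Between Γ e w (ρ.1 n)}).NeBot := frequently_mem_iff_neBot.1 hw
  -- The ultrafilter is concentrated on those `n` for which a geodesic from `e` to `ρ n` can be
  -- routed through `w`; the limit of these geodesics still passes through `w`.
  set U := Ultrafilter.of (atTop ⊓ 𝓟 {n | Between Γ e w (ρ.1 n)})
  have hU : (U : Filter ℕ) ≤ atTop ⊓ 𝓟 {n | Between Γ e w (ρ.1 n)} := Ultrafilter.of_le _
  have hUt : (U : Filter ℕ) ≤ atTop := hU.trans inf_le_left
  have hUw : ∀ᶠ n in U, Between Γ e w (ρ.1 n) := (hU.trans inf_le_right) (mem_principal_self _)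
  have key : ∀ n, ∃ σ, IsGeodesic Γ e (ρ.1 n) σ ∧
      (Between Γ e w (ρ.1 n) → σ (Γ.dist e w) = w) := by
    intro n
    by_cases h : Between Γ e w (ρ.1 n)
    · obtain ⟨σ, h1, h2⟩ := h.exists_isGeodesic hc
      exact ⟨σ, h1, fun _ => h2⟩
    · obtain ⟨σ, h1⟩ := exists_isGeodesic hc e (ρ.1 n)
      exact ⟨σ, h1, fun h' => absurd h' h⟩
  choose σ hσ hσw using key
  have hfar : ∀ t, ∀ᶠ n in U, t ≤ n ∧ t ≤ Γ.dist e (ρ.1 n) := by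
    intro t
    filter_upwards [hUt (eventually_ge_atTop (t + Γ.dist e (ρ.1 0)))] with n hn
    have := hc.dist_triangle (u := ρ.1 0) (v := e) (w := ρ.1 n)
    rw [ρ.dist_zero, Γ.dist_comm (u := ρ.1 0)] at this
    omega
  obtain ⟨l, hl⟩ := exists_limit_ray (Γ := Γ) U σ
    (fun t => ⟨_, hfin e t, by
      filter_upwards [hfar t] with n hn
      exact ((hσ n).dist_start hn.2).le⟩)
    (fun m n => by
      filter_upwards [hfar (m + n)] with i hi
      exact (hσ i).2.2 m n hi.2)
  refine ⟨l, ?_, ?_, asymptotic_of_dist_le hc (C := D + 3 * Γ.dist e (ρ.1 0)) fun t => ?_⟩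
  · obtain ⟨n, hn⟩ := (hl 0).exists
    rw [← hn, (hσ n).1]
  · obtain ⟨n, hn, hn'⟩ := ((hl (Γ.dist e w)).and hUw).exists
    rw [← hn, hσw n hn']
  · obtain ⟨n, hn, hn'⟩ := ((hl t).and (hfar t)).exists
    have h1 := (hσ n).dist_start hn'.2
    have := dist_le_of_between_ray hc hD ρ ((hσ n).between hn'.2)
    rwa [h1, hn] at this

theorem exists_ray_endpoint (hc : Γ.Connected) {D : ℕ} (hD : Thin Γ D)
    (hfin : ∀ x n, {y | Γ.dist x y ≤ n}.Finite) (e : V) (u : GromovBoundary Γ) :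
    ∃ l : GeodesicRay Γ, l.1 0 = e ∧ l.endpoint = u := by
  obtain ⟨ρ, rfl⟩ := exists_endpoint u
  obtain ⟨l, h1, -, h2⟩ := exists_ray_asymptotic hc hD hfin ρ e e
    (Frequently.of_forall fun n => between_left e _)
  exact ⟨l, h1, endpoint_eq_iff.2 h2⟩

end Limits

/-! ### Topology of the Gromov boundary -/

section BoundaryTopology

open Filter

variable {V : Type*} {Γ : SimpleGraph V}

theorem le_nhds_ray_iff {f : Filter (GeodesicRay Γ)} {l : GeodesicRay Γ} :
    f ≤ 𝓝 l ↔ ∀ t, ∀ᶠ l' in f, l'.1 t = l.1 t := by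
  let _ : TopologicalSpace V := ⊥
  have : DiscreteTopology V := ⟨rfl⟩
  rw [show 𝓝 l = comap Subtype.val (𝓝 l.1) from nhds_induced Subtype.val l]
  refine map_le_iff_le_comap.symm.trans ?_
  refine (tendsto_pi_nhds (f := fun l' : GeodesicRay Γ => l'.1)).trans ?_
  simp only [nhds_discrete, tendsto_pure]

theorem isOpen_setOf_ray (p : V → Prop) (t : ℕ) : IsOpen {l : GeodesicRay Γ | p (l.1 t)} := by
  rw [isOpen_iff_mem_nhds]
  intro l hl
  filter_upwards [(le_nhds_ray_iff (f := 𝓝 l)).1 le_rfl t] with l' hl'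
  simpa only [mem_ofPred_eq, hl'] using hl

theorem continuous_endpoint : Continuous (GeodesicRay.endpoint (Γ := Γ)) :=
  continuous_coinduced_rng

theorem secondCountable_ray (hc : Γ.Connected) (hfin : ∀ x n, {y | Γ.dist x y ≤ n}.Finite) :
    SecondCountableTopology (GeodesicRay Γ) := by
  have : Countable V := by
    obtain ⟨e⟩ := hc.nonempty
    rw [← countable_univ_iff]
    refine (countable_iUnion fun n => (hfin e n).countable).mono fun y _ => ?_
    exact mem_iUnion.2 ⟨Γ.dist e y, le_refl (Γ.dist e y)⟩
  let _ : TopologicalSpace V := ⊥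
  have : DiscreteTopology V := ⟨rfl⟩
  exact TopologicalSpace.secondCountableTopology_induced _ _ (Subtype.val)

theorem isCompact_rays (hfin : ∀ x n, {y | Γ.dist x y ≤ n}.Finite) (e : V) :
    IsCompact {l : GeodesicRay Γ | l.1 0 = e} := by
  rw [isCompact_iff_ultrafilter_le_nhds]
  intro f hf
  have hf' : ∀ᶠ l : GeodesicRay Γ in f, l.1 0 = e := hf (mem_principal_self _)
  obtain ⟨l, hl⟩ := exists_limit_ray (Γ := Γ) f (fun l => l.1)
    (fun t => ⟨_, hfin e t, by
      filter_upwards [hf'] with l hl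
      have := l.dist_zero t
      rw [hl] at this
      exact this.le⟩)
    (fun m n => Eventually.of_forall fun l => l.2 m n)
  refine ⟨l, ?_, le_nhds_ray_iff.2 hl⟩
  obtain ⟨l', h1, h2⟩ := ((hl 0).and hf').exists
  rw [mem_ofPred_eq, ← h1, h2]

/-- The end points of a closed set of rays with a common origin form a closed set. -/
theorem isClosed_image_endpoint (hc : Γ.Connected) {D : ℕ} (hD : Thin Γ D)
    (hfin : ∀ x n, {y | Γ.dist x y ≤ n}.Finite) {e : V} {K : Set (GeodesicRay Γ)}
    (hK : IsClosed K) (hKe : ∀ l ∈ K, l.1 0 = e) :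
    IsClosed (GeodesicRay.endpoint '' K) := by
  -- In the quotient topology closedness is tested on rays with arbitrary origins. Each such ray is
  -- replaced by an asymptotic one in the compact set `K`; the distance of the two is bounded in
  -- terms of their origins, and the bound survives in the limit.
  refine isClosed_coinduced.2 (isClosed_iff_ultrafilter.2 fun l f hf hmem => ?_)
  have hKc : IsCompact K := (isCompact_rays hfin e).of_isClosed_subset hK hKe
  have : ∀ x : GeodesicRay Γ, ∃ y : GeodesicRay Γ, x.endpoint ∈ GeodesicRay.endpoint '' K →
      y ∈ K ∧ y.endpoint = x.endpoint := by
    intro x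
    by_cases h : x.endpoint ∈ GeodesicRay.endpoint '' K
    · obtain ⟨y, h1, h2⟩ := h
      exact ⟨y, fun _ => ⟨h1, h2⟩⟩
    · exact ⟨x, fun h' => absurd h' h⟩
  choose φ hφ using this
  have hev : ∀ᶠ x in f, φ x ∈ K ∧ (φ x).endpoint = x.endpoint := by
    filter_upwards [hmem] with x hx
    exact hφ x hx
  obtain ⟨l', hl'K, hl'⟩ := isCompact_iff_ultrafilter_le_nhds.1 hKc (f.map φ) (by
    rw [le_principal_iff]
    exact hev.mono fun x hx => hx.1)
  refine ⟨l', hl'K, endpoint_eq_iff.2 ?_⟩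
  refine asymptotic_of_dist_le hc (C := 2 * D + 3 * Γ.dist (l.1 0) e) fun t => ?_
  have h1 := le_nhds_ray_iff.1 hf
  have h2 : ∀ t, ∀ᶠ x in f, (φ x).1 t = l'.1 t := fun t => le_nhds_ray_iff.1 hl' t
  obtain ⟨x, h3, h4, h5, h6⟩ := (hev.and ((h1 t).and ((h2 t).and (h1 0)))).exists
  have := (endpoint_eq_iff.1 h3.2).dist_le' hc hD t
  rwa [h4, h5, h6, hKe _ h3.1] at this

/-- The complement is the set of end points of the closed set of rays from `e` outside `W`. This
replaces openness of the end point map. -/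
theorem isOpen_setOf_forall_ray (hc : Γ.Connected) {D : ℕ} (hD : Thin Γ D)
    (hfin : ∀ x n, {y | Γ.dist x y ≤ n}.Finite) (e : V) {W : Set (GeodesicRay Γ)}
    (hW : IsOpen W) :
    IsOpen {u : GromovBoundary Γ | ∀ l : GeodesicRay Γ, l.1 0 = e → l.endpoint = u → l ∈ W} := by
  have := isClosed_image_endpoint hc hD hfin (e := e) (K := {l | l.1 0 = e} ∩ Wᶜ)
    ((⟨by simpa [compl_ofPred] using isOpen_setOf_ray (fun v => v ≠ e) 0⟩ :
      IsClosed {l : GeodesicRay Γ | l.1 0 = e}).inter hW.isClosed_compl) (fun l hl => hl.1)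
  convert this.isOpen_compl using 1
  ext u
  simp only [mem_ofPred_eq, mem_compl_iff, mem_image, mem_inter_iff, not_exists, not_and]
  refine forall_congr' fun l => ⟨fun h h1 h2 => h1.2 (h h1.1 h2), fun h h1 h2 => ?_⟩
  by_contra h3
  exact h ⟨h1, h3⟩ h2

/-- The points all of whose rays from `e` are `D`-close to a given sequence up to time `T` form an
open set. -/
theorem isOpen_setOf_dist_le (hc : Γ.Connected) {D : ℕ} (hD : Thin Γ D)
    (hfin : ∀ x n, {y | Γ.dist x y ≤ n}.Finite) (e : V) (σ : ℕ → V) (R T : ℕ) :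
    IsOpen {u : GromovBoundary Γ | ∀ l : GeodesicRay Γ, l.1 0 = e → l.endpoint = u →
      ∀ t ≤ T, Γ.dist (l.1 t) (σ t) ≤ R} := by
  refine isOpen_setOf_forall_ray hc hD hfin e (W := {l | ∀ t ≤ T, Γ.dist (l.1 t) (σ t) ≤ R}) ?_
  have : {l : GeodesicRay Γ | ∀ t ≤ T, Γ.dist (l.1 t) (σ t) ≤ R} =
      ⋂ t ∈ Iic T, {l : GeodesicRay Γ | Γ.dist (l.1 t) (σ t) ≤ R} := by
    ext l; simp
  rw [this]
  exact (finite_Iic T).isOpen_biInter fun t _ => isOpen_setOf_ray (fun v => Γ.dist v (σ t) ≤ R) t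

/-- Rays to distinct points are more than `2D` apart at some time `t`, and no ray is `D`-close to
both of them at that time. -/
theorem t2Space_boundary (hc : Γ.Connected) {D : ℕ} (hD : Thin Γ D)
    (hfin : ∀ x n, {y | Γ.dist x y ≤ n}.Finite) : T2Space (GromovBoundary Γ) := by
  refine ⟨fun u v huv => ?_⟩
  obtain ⟨e⟩ := hc.nonempty
  obtain ⟨l, hl, rfl⟩ := exists_ray_endpoint hc hD hfin e u
  obtain ⟨l', hl', rfl⟩ := exists_ray_endpoint hc hD hfin e v
  obtain ⟨t, ht⟩ : ∃ t, 2 * D < Γ.dist (l.1 t) (l'.1 t) := by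
    by_contra! h
    exact huv (endpoint_eq_iff.2 (asymptotic_of_dist_le hc h))
  refine ⟨_, _, isOpen_setOf_dist_le hc hD hfin e l.1 D t,
    isOpen_setOf_dist_le hc hD hfin e l'.1 D t,
    fun l₁ h1 h2 s _ => (endpoint_eq_iff.1 h2).dist_le hc hD (h1.trans hl.symm) s,
    fun l₁ h1 h2 s _ => (endpoint_eq_iff.1 h2).dist_le hc hD (h1.trans hl'.symm) s, ?_⟩
  rw [Set.disjoint_left]
  intro w h1 h2
  obtain ⟨l₁, h3, h4⟩ := exists_ray_endpoint hc hD hfin e w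
  have h5 := h1 l₁ h3 h4 t le_rfl
  have h6 := h2 l₁ h3 h4 t le_rfl
  have h7 := hc.dist_triangle (u := l.1 t) (v := l₁.1 t) (w := l'.1 t)
  rw [Γ.dist_comm (u := l.1 t) (v := l₁.1 t)] at h7
  omega

theorem compactSpace_boundary (hc : Γ.Connected) {D : ℕ} (hD : Thin Γ D)
    (hfin : ∀ x n, {y | Γ.dist x y ≤ n}.Finite) : CompactSpace (GromovBoundary Γ) := by
  obtain ⟨e⟩ := hc.nonempty
  refine ⟨?_⟩
  convert (isCompact_rays hfin e).image (continuous_endpoint (Γ := Γ))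
  refine (eq_univ_of_forall fun u => ?_).symm
  obtain ⟨l, h1, h2⟩ := exists_ray_endpoint hc hD hfin e u
  exact ⟨l, h1, h2⟩

/-- The rays from `e` to a given point form a compact set, so finitely many basic open sets of rays
cover it inside a given open set. The sets `F c`, for finite families `c` of basic open sets,
therefore form a countable basis. -/
theorem secondCountable_boundary (hc : Γ.Connected) {D : ℕ} (hD : Thin Γ D)
    (hfin : ∀ x n, {y | Γ.dist x y ≤ n}.Finite) : SecondCountableTopology (GromovBoundary Γ) := by
  obtain ⟨e⟩ := hc.nonempty
  have := secondCountable_ray hc hfin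
  have := t2Space_boundary hc hD hfin
  set b := TopologicalSpace.countableBasis (GeodesicRay Γ)
  have hb : TopologicalSpace.IsTopologicalBasis b := TopologicalSpace.isBasis_countableBasis _
  set F : Set (Set (GeodesicRay Γ)) → Set (GromovBoundary Γ) := fun c =>
    {u | ∀ l : GeodesicRay Γ, l.1 0 = e → l.endpoint = u → l ∈ ⋃₀ c}
  refine TopologicalSpace.IsTopologicalBasis.secondCountableTopology
    (b := F '' {c | c.Finite ∧ c ⊆ b}) ?_
    ((countable_ofPred_finite_subset (TopologicalSpace.countable_countableBasis _)).image _)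
  refine TopologicalSpace.isTopologicalBasis_of_isOpen_of_nhds ?_ ?_
  · rintro _ ⟨c, hc', rfl⟩
    exact isOpen_setOf_forall_ray hc hD hfin e
      (isOpen_sUnion fun s hs => hb.isOpen (hc'.2 hs))
  · intro u O hu hO
    have hcl : IsClosed {l : GeodesicRay Γ | l.endpoint = u} :=
      isClosed_singleton.preimage continuous_endpoint
    have hcomp : IsCompact ({l : GeodesicRay Γ | l.1 0 = e} ∩ {l | l.endpoint = u}) :=
      (isCompact_rays hfin e).inter_right hcl
    have hO' : IsOpen (GeodesicRay.endpoint ⁻¹' O) := hO.preimage (continuous_endpoint (Γ := Γ))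
    obtain ⟨c, hcb, hcfin, hcov⟩ := hcomp.elim_finite_subcover_image
      (b := {s | s ∈ b ∧ s ⊆ GeodesicRay.endpoint ⁻¹' O}) (c := id)
      (fun s hs => hb.isOpen hs.1) (by
        rintro l ⟨-, hl⟩
        obtain ⟨s, h1, h2, h3⟩ := hb.exists_subset_of_mem_open (show l ∈ GeodesicRay.endpoint ⁻¹' O by
          rw [mem_preimage, hl]; exact hu) hO'
        exact mem_biUnion (show s ∈ {s | s ∈ b ∧ s ⊆ GeodesicRay.endpoint ⁻¹' O} from ⟨h1, h3⟩) h2)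
    refine ⟨F c, ⟨c, ⟨hcfin, fun s hs => (hcb hs).1⟩, rfl⟩, ?_, ?_⟩
    · intro l h1 h2
      obtain ⟨s, hs, hls⟩ := mem_iUnion₂.1 (hcov ⟨h1, h2⟩)
      exact ⟨s, hs, hls⟩
    · intro v hv
      obtain ⟨l, h1, rfl⟩ := exists_ray_endpoint hc hD hfin e v
      obtain ⟨s, hs, hls⟩ := hv l h1 rfl
      exact (hcb hs).2 hls

/-- Uniform continuity on a compact set, in terms of fellow travelling rays. -/
theorem exists_forall_norm_sub_lt (hc : Γ.Connected) {D : ℕ} (hD : Thin Γ D)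
    (hfin : ∀ x n, {y | Γ.dist x y ≤ n}.Finite) (e : V) {s : Set (GromovBoundary Γ)}
    {f : s → ℂ} (hf : Continuous f) {K : Set s} (hK : IsCompact K) {ε : ℝ} (hε : 0 < ε) (R : ℕ) :
    ∃ T : ℕ, ∀ u ∈ K, ∀ v ∈ K, ∀ l l' : GeodesicRay Γ, l.1 0 = e → l'.1 0 = e →
      l.endpoint = u → l'.endpoint = v → (∀ t ≤ T, Γ.dist (l.1 t) (l'.1 t) ≤ R) →
        ‖f v - f u‖ < ε := by
  -- Otherwise there are counterexamples for every `T`. Their rays converge along an ultrafilter to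
  -- two rays that are `R`-close at all times, so both sequences of end points have the same limit,
  -- contrary to continuity of `f` there.
  by_contra! h
  choose u hu v hv l l' hl hl' hlu hlv hll hfuv using h
  obtain ⟨u', hu'K, hu'⟩ := isCompact_iff_ultrafilter_le_nhds.1 hK ((hyperfilter ℕ).map u) (by
    rw [le_principal_iff]; exact Eventually.of_forall (f := hyperfilter ℕ) hu)
  obtain ⟨v', hv'K, hv'⟩ := isCompact_iff_ultrafilter_le_nhds.1 hK ((hyperfilter ℕ).map v) (by
    rw [le_principal_iff]; exact Eventually.of_forall (f := hyperfilter ℕ) hv)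
  obtain ⟨m, -, hm⟩ := isCompact_iff_ultrafilter_le_nhds.1 (isCompact_rays hfin e)
    ((hyperfilter ℕ).map l) (by rw [le_principal_iff]; exact Eventually.of_forall (f := hyperfilter ℕ) hl)
  obtain ⟨m', -, hm'⟩ := isCompact_iff_ultrafilter_le_nhds.1 (isCompact_rays hfin e)
    ((hyperfilter ℕ).map l') (by rw [le_principal_iff]; exact Eventually.of_forall (f := hyperfilter ℕ) hl')
  have := t2Space_boundary hc hD hfin
  replace hu' : Tendsto u (hyperfilter ℕ) (𝓝 u') := hu'
  replace hv' : Tendsto v (hyperfilter ℕ) (𝓝 v') := hv'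
  replace hm : Tendsto l (hyperfilter ℕ) (𝓝 m) := hm
  replace hm' : Tendsto l' (hyperfilter ℕ) (𝓝 m') := hm'
  have h1 : m.endpoint = u' := by
    refine tendsto_nhds_unique ((continuous_endpoint.tendsto m).comp hm) ?_
    exact ((continuous_subtype_val.tendsto u').comp hu').congr fun n => (hlu n).symm
  have h2 : m'.endpoint = v' := by
    refine tendsto_nhds_unique ((continuous_endpoint.tendsto m').comp hm') ?_
    exact ((continuous_subtype_val.tendsto v').comp hv').congr fun n => (hlv n).symm
  have h3 : m.endpoint = m'.endpoint := by
    refine endpoint_eq_iff.2 (asymptotic_of_dist_le hc (C := R) fun t => ?_)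
    have h4 : ∀ᶠ n in hyperfilter ℕ, t ≤ n :=
      (hyperfilter_le_cofinite.trans Nat.cofinite_eq_atTop.le) (eventually_ge_atTop t)
    have h5 : ∀ᶠ n in hyperfilter ℕ, (l n).1 t = m.1 t := le_nhds_ray_iff.1 hm t
    have h6 : ∀ᶠ n in hyperfilter ℕ, (l' n).1 t = m'.1 t := le_nhds_ray_iff.1 hm' t
    obtain ⟨n, h4, h5, h6⟩ := (h4.and (h5.and h6)).exists
    have := hll n t h4
    rwa [h5, h6] at this
  have h4 : u' = v' := Subtype.ext (by rw [← h1, ← h2, h3])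
  subst h4
  have h5 : Tendsto (fun n => ‖f (v n) - f (u n)‖) (hyperfilter ℕ) (𝓝 ‖f u' - f u'‖) :=
    (((hf.tendsto u').comp hv').sub ((hf.tendsto u').comp hu')).norm
  rw [sub_self, norm_zero] at h5
  obtain ⟨n, hn⟩ := (h5.eventually_lt_const hε).exists
  exact absurd hn (not_lt.2 (hfuv n))

end BoundaryTopology

/-! ### The Cayley graph -/

section Cayley

variable {G : Type*} [Group G] {S : Set G}

theorem connected_mulCayley (hS : Subgroup.closure S = ⊤) :
    (SimpleGraph.mulCayley S).Connected := by
  have step : ∀ s ∈ S, ∀ a : G, (SimpleGraph.mulCayley S).Reachable a (a * s) := by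
    intro s hs a
    by_cases h : a = a * s
    · rw [← h]
    · exact SimpleGraph.Adj.reachable ((SimpleGraph.mulCayley_adj' S _ _).2 ⟨h, s, hs, Or.inl rfl⟩)
  have key : ∀ x : G, ∀ a : G, (SimpleGraph.mulCayley S).Reachable a (a * x) := by
    intro x
    have hx : x ∈ Subgroup.closure S := by rw [hS]; trivial
    induction hx using Subgroup.closure_induction with
    | mem s hs => exact step s hs
    | one => intro a; rw [mul_one]
    | mul x y _ _ hx hy => intro a; rw [← mul_assoc]; exact (hx a).trans (hy _)
    | inv x _ hx =>
      intro a
      have := hx (a * x⁻¹)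
      rw [inv_mul_cancel_right] at this
      exact this.symm
  have : Nonempty G := ⟨1⟩
  exact ⟨fun a b => by simpa using key (a⁻¹ * b) a⟩

theorem finite_ball {V : Type*} {Γ : SimpleGraph V} (hc : Γ.Connected)
    (h : ∀ v, {w | Γ.Adj v w}.Finite) (x : V) (n : ℕ) : {y | Γ.dist x y ≤ n}.Finite := by
  induction n with
  | zero =>
    refine (finite_singleton x).subset fun y hy => ?_
    exact (hc.dist_eq_zero_iff.1 (Nat.le_zero.1 hy)).symm
  | succ n ih =>
    refine (ih.union (ih.biUnion fun v _ => h v)).subset fun y hy => ?_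
    rcases Nat.lt_or_ge n (Γ.dist x y) with h1 | h1
    · obtain ⟨u, hu, hu'⟩ := exists_between hc (x := x) (y := y) (n := n) h1.le
      refine Or.inr (mem_biUnion (x := u) hu'.le (SimpleGraph.dist_eq_one_iff_adj.1 ?_))
      have : Γ.dist x y ≤ n + 1 := hy
      unfold Between at hu
      omega
    · exact Or.inl h1

theorem finite_ball_mulCayley (hSfin : S.Finite) (hS : Subgroup.closure S = ⊤) (x : G) (n : ℕ) :
    {y | wordDist S x y ≤ n}.Finite := by
  refine finite_ball (connected_mulCayley hS) (fun v => ?_) x n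
  refine ((hSfin.image (v * ·)).union (hSfin.image (v * ·⁻¹))).subset fun w hw => ?_
  obtain ⟨-, s, hs, h | h⟩ := (SimpleGraph.mulCayley_adj' S _ _).1 hw
  · exact Or.inl ⟨s, hs, h⟩
  · exact Or.inr ⟨s, hs, by simp [h]⟩

end Cayley

/-! ### Metric estimates in the augmented space -/

section AugmentedSpace

variable {G : Type*} {C : ℕ → Set G}

/-- The element of the group over which a vertex lies. -/
def AugVertex.proj : AugVertex C → G
  | .base x => x
  | .horo _ p _ => p

/-- The level of a vertex in the `i`-th horoball, and `0` outside of this horoball. -/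
def AugVertex.depth (i : ℕ) : AugVertex C → ℕ
  | .base _ => 0
  | .horo j _ l => if j = i then l + 1 else 0

@[simp] theorem AugVertex.proj_pt (i : ℕ) (x : C i × ℕ) : (AugVertex.pt i x).proj = x.1 := by
  rcases x with ⟨p, _ | l⟩ <;> rfl

theorem AugVertex.depth_pt (i j : ℕ) (x : C j × ℕ) :
    (AugVertex.pt j x).depth i = if j = i then x.2 else 0 := by
  rcases x with ⟨p, _ | l⟩ <;> simp [AugVertex.pt, AugVertex.depth]

@[simp] theorem AugVertex.depth_pt_self (i : ℕ) (x : C i × ℕ) :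
    (AugVertex.pt i x).depth i = x.2 := by
  simp [AugVertex.depth_pt]

theorem AugVertex.depth_pt_of_ne {i j : ℕ} (h : j ≠ i) (x : C j × ℕ) :
    (AugVertex.pt j x).depth i = 0 := by
  simp [AugVertex.depth_pt, h]

theorem AugVertex.exists_pt_of_depth_pos {i : ℕ} {x : AugVertex C} (h : 0 < x.depth i) :
    ∃ p, x = AugVertex.pt i (p, x.depth i) := by
  rcases x with a | ⟨j, p, l⟩
  · simp [AugVertex.depth] at h
  · by_cases hj : j = i
    · subst hj
      exact ⟨p, by simp [AugVertex.depth, AugVertex.pt]⟩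
    · simp [AugVertex.depth, hj] at h

theorem AugVertex.pt_injective (i : ℕ) : Function.Injective (AugVertex.pt (C := C) i) := by
  intro x y h
  have h1 := congrArg AugVertex.proj h
  have h2 := congrArg (AugVertex.depth i) h
  rw [AugVertex.proj_pt, AugVertex.proj_pt] at h1
  rw [AugVertex.depth_pt_self, AugVertex.depth_pt_self] at h2
  exact Prod.ext (Subtype.ext h1) h2

variable [Group G] {S : Set G}

theorem augmentedSpace_adj_cases {x y : AugVertex C} (h : (augmentedSpace S C).Adj x y) :
    (∃ a b, x = .base a ∧ y = .base b ∧ wordDist S a b ≤ 1) ∨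
    (∃ j p q l, x = .pt j (p, l) ∧ y = .pt j (q, l) ∧ wordDist S p q ≤ 2 ^ l) ∨
    (∃ j p l, x = .pt j (p, l) ∧ y = .pt j (p, l + 1)) ∨
    (∃ j p l, x = .pt j (p, l + 1) ∧ y = .pt j (p, l)) := by
  simp only [augmentedSpace, SimpleGraph.sup_adj, SimpleGraph.iSup_adj] at h
  rcases h with ⟨-, a, b, h, rfl, rfl⟩ | ⟨i, -, ⟨p, l⟩, ⟨q, m⟩, h, rfl, rfl⟩
  · exact Or.inl ⟨a, b, rfl, rfl, dist_le_one_of_adj h⟩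
  · rw [combinatorialHoroball, SimpleGraph.fromRel_adj] at h
    rcases h with ⟨-, (⟨h1, -, h2⟩ | ⟨h1, h2⟩) | (⟨h1, -, h2⟩ | ⟨h1, h2⟩)⟩
    · dsimp only at h1 h2
      subst h1
      exact Or.inr (Or.inl ⟨i, p, q, l, rfl, rfl, h2⟩)
    · dsimp only at h1 h2
      subst h1 h2
      exact Or.inr (Or.inr (Or.inl ⟨i, p, l, rfl, rfl⟩))
    · dsimp only at h1 h2
      subst h1
      exact Or.inr (Or.inl ⟨i, p, q, m, rfl, rfl, by rw [wordDist, SimpleGraph.dist_comm]; exact h2⟩)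
    · dsimp only at h1 h2
      subst h1 h2
      exact Or.inr (Or.inr (Or.inr ⟨i, q, m, rfl, rfl⟩))

theorem depth_le_of_adj (i : ℕ) {x y : AugVertex C} (h : (augmentedSpace S C).Adj x y) :
    x.depth i ≤ y.depth i + 1 := by
  rcases augmentedSpace_adj_cases h with ⟨a, b, rfl, rfl, -⟩ | ⟨j, p, q, l, rfl, rfl, -⟩ |
    ⟨j, p, l, rfl, rfl⟩ | ⟨j, p, l, rfl, rfl⟩
  · simp [AugVertex.depth]
  all_goals
    simp only [AugVertex.depth_pt]
    split_ifs <;> omega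

/-- The neighbours of a vertex of positive level of the `i`-th horoball. -/
theorem adj_cases_of_pos {i : ℕ} {p : C i} {a : ℕ} (ha : 0 < a) {y : AugVertex C}
    (h : (augmentedSpace S C).Adj (.pt i (p, a)) y) :
    ∃ q b, y = .pt i (q, b) ∧
      ((b = a ∧ wordDist S p q ≤ 2 ^ a) ∨ (q = p ∧ (b = a + 1 ∨ a = b + 1))) := by
  have key : ∀ j (x : C j × ℕ), AugVertex.pt i (p, a) = AugVertex.pt j x →
      j = i := by
    intro j x hx
    have := congrArg (AugVertex.depth i) hx
    rw [AugVertex.depth_pt_self, AugVertex.depth_pt] at this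
    by_contra hj
    rw [if_neg hj] at this
    dsimp only at this
    omega
  rcases augmentedSpace_adj_cases h with ⟨c, b, h1, rfl, -⟩ | ⟨j, r, q, l, h1, rfl, h2⟩ |
    ⟨j, r, l, h1, rfl⟩ | ⟨j, r, l, h1, rfl⟩
  · have := congrArg (AugVertex.depth i) h1
    rw [AugVertex.depth_pt_self] at this
    simp only [AugVertex.depth] at this
    omega
  · obtain rfl := key j _ h1
    obtain ⟨rfl, rfl⟩ := Prod.mk.inj (AugVertex.pt_injective _ h1)
    exact ⟨q, a, rfl, Or.inl ⟨rfl, h2⟩⟩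
  · obtain rfl := key j _ h1
    obtain ⟨rfl, rfl⟩ := Prod.mk.inj (AugVertex.pt_injective _ h1)
    exact ⟨p, a + 1, rfl, Or.inr ⟨rfl, Or.inl rfl⟩⟩
  · obtain rfl := key j _ h1
    obtain ⟨rfl, rfl⟩ := Prod.mk.inj (AugVertex.pt_injective _ h1)
    exact ⟨p, l, rfl, Or.inr ⟨rfl, Or.inr rfl⟩⟩

theorem adj_horizontal (hc : (SimpleGraph.mulCayley S).Connected) {i : ℕ} {p q : C i} {a : ℕ}
    (hne : p ≠ q) (h : wordDist S p q ≤ 2 ^ a) :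
    (augmentedSpace S C).Adj (.pt i (p, a)) (.pt i (q, a)) := by
  have hne' : ((p, a) : C i × ℕ) ≠ (q, a) := fun h => hne (Prod.mk.inj h).1
  simp only [augmentedSpace, SimpleGraph.sup_adj, SimpleGraph.iSup_adj]
  refine Or.inr ⟨i, fun h => hne' (AugVertex.pt_injective i h), (p, a), (q, a), ?_, rfl, rfl⟩
  rw [combinatorialHoroball, SimpleGraph.fromRel_adj]
  exact ⟨hne', Or.inl (Or.inl ⟨rfl, hc.pos_dist_of_ne fun h => hne (Subtype.ext h), h⟩)⟩

theorem adj_base {a b : G} (h : (SimpleGraph.mulCayley S).Adj a b) :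
    (augmentedSpace S C).Adj (.base a) (.base b) := by
  simp only [augmentedSpace, SimpleGraph.sup_adj]
  exact Or.inl ⟨fun h' => h.ne (AugVertex.base.inj h'), a, b, h, rfl, rfl⟩

theorem exists_base_walk {a b : G} (w : (SimpleGraph.mulCayley S).Walk a b) :
    ∃ w' : (augmentedSpace S C).Walk (.base a) (.base b), w'.length = w.length := by
  induction w with
  | nil => exact ⟨.nil, rfl⟩
  | cons h w ih =>
    obtain ⟨w', hw'⟩ := ih
    exact ⟨.cons (adj_base h) w', by simp [hw']⟩

theorem dist_base_le (hc : (SimpleGraph.mulCayley S).Connected) (a b : G) :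
    (augmentedSpace S C).dist (.base a) (.base b) ≤ wordDist S a b := by
  obtain ⟨w, hw⟩ := hc.exists_walk_length_eq_dist a b
  obtain ⟨w', hw'⟩ := exists_base_walk (C := C) w
  exact (SimpleGraph.dist_le w').trans (by rw [hw', hw]; exact le_rfl)

theorem connected_augmentedSpace (hc : (SimpleGraph.mulCayley S).Connected) :
    (augmentedSpace S C).Connected := by
  have key : ∀ x : AugVertex C, (augmentedSpace S C).Reachable (.base x.proj) x := by
    rintro (a | ⟨j, p, l⟩)
    · exact SimpleGraph.Reachable.refl _
    · obtain ⟨w, -⟩ := exists_vertical_walk S j p 0 (l + 1)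
      rw [zero_add] at w
      exact ⟨w⟩
  have : Nonempty (AugVertex C) := ⟨.base 1⟩
  refine ⟨fun x y => (key x).symm.trans (SimpleGraph.Reachable.trans ?_ (key y))⟩
  obtain ⟨w, -⟩ := hc.exists_walk_length_eq_dist x.proj y.proj
  obtain ⟨w', -⟩ := exists_base_walk (C := C) w
  exact ⟨w'⟩

/-- A short path from a vertex does not move its projection far. -/
theorem wordDist_proj_add_le (hc : (SimpleGraph.mulCayley S).Connected) {x y : AugVertex C}
    (w : (augmentedSpace S C).Walk x y) :
    wordDist S x.proj y.proj + 2 ^ x.level ≤ 2 ^ (w.length + y.level) := by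
  induction w with
  | nil => simp [wordDist]
  | @cons x z y h w ih =>
    have tri : wordDist S x.proj y.proj ≤ wordDist S x.proj z.proj + wordDist S z.proj y.proj :=
      hc.dist_triangle
    rw [SimpleGraph.Walk.length_cons,
      show w.length + 1 + y.level = (w.length + y.level) + 1 by ring, pow_succ]
    have pos : 1 ≤ 2 ^ (w.length + y.level) := Nat.one_le_two_pow
    -- The exponential bound doubles with each edge. A horizontal edge at level `l` moves the
    -- projection by at most `2 ^ l`, and a descent halves the summand `2 ^ level`; the doubling
    -- pays for either.
    rcases augmentedSpace_adj_cases h with ⟨a, b, rfl, rfl, h1⟩ | ⟨j, p, q, l, rfl, rfl, h1⟩ |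
      ⟨j, p, l, rfl, rfl⟩ | ⟨j, p, l, rfl, rfl⟩
    · simp only [AugVertex.proj, AugVertex.level] at *
      omega
    · simp only [AugVertex.proj_pt, AugVertex.level_pt] at *
      omega
    · simp only [AugVertex.proj_pt, AugVertex.level_pt, pow_succ] at *
      omega
    · simp only [AugVertex.proj_pt, AugVertex.level_pt, pow_succ] at *
      omega

theorem wordDist_proj_add_dist_le (hc : (SimpleGraph.mulCayley S).Connected) (x y : AugVertex C) :
    wordDist S x.proj y.proj + 2 ^ x.level ≤ 2 ^ ((augmentedSpace S C).dist x y + y.level) := by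
  obtain ⟨w, hw⟩ := (connected_augmentedSpace (C := C) hc).exists_walk_length_eq_dist x y
  rw [← hw]
  exact wordDist_proj_add_le hc w

/-- The exponential estimate bounds both the projection and the level of a point of the ball, and
each group element lies in finitely many of the sets `C j`. -/
theorem finite_ball_augmentedSpace (hSfin : S.Finite) (hS : Subgroup.closure S = ⊤)
    (hC : ∀ x : G, {j | x ∈ C j}.Finite) (x : AugVertex C) (n : ℕ) :
    {y | (augmentedSpace S C).dist x y ≤ n}.Finite := by
  have hc := connected_mulCayley hS
  have hF := finite_ball_mulCayley hSfin hS x.proj (2 ^ (n + x.level))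
  set F := {y | wordDist S x.proj y ≤ 2 ^ (n + x.level)}
  have hfin : (AugVertex.base (C := C) '' F ∪ ⋃ a ∈ F, ⋃ j ∈ {j | a ∈ C j},
      ⋃ l ∈ Iic (n + x.level), {y | ∃ h : a ∈ C j, y = AugVertex.horo j ⟨a, h⟩ l}).Finite := by
    refine (hF.image _).union (hF.biUnion fun a _ => (hC a).biUnion fun j _ =>
      (finite_Iic _).biUnion fun l _ => Set.Subsingleton.finite ?_)
    rintro y ⟨h, rfl⟩ z ⟨h', rfl⟩
    rfl
  refine hfin.subset fun y hy => ?_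
  have h1 := wordDist_proj_add_dist_le (C := C) hc y x
  rw [(augmentedSpace S C).dist_comm] at h1
  have h2 : 2 ^ ((augmentedSpace S C).dist x y + x.level) ≤ 2 ^ (n + x.level) :=
    Nat.pow_le_pow_right (by norm_num) (Nat.add_le_add_right hy _)
  have h3 : y.proj ∈ F := by
    change wordDist S x.proj y.proj ≤ _
    rw [wordDist, SimpleGraph.dist_comm]
    exact (Nat.le_add_right _ _).trans (h1.trans h2)
  have h4 : y.level ≤ n + x.level :=
    (Nat.pow_le_pow_iff_right (by norm_num : 1 < 2)).1 ((Nat.le_add_left _ _).trans (h1.trans h2))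
  rcases y with a | ⟨j, ⟨a, ha⟩, l⟩
  · exact Or.inl ⟨a, h3, rfl⟩
  · refine Or.inr ?_
    simp only [mem_iUnion]
    exact ⟨a, h3, j, ha, l, (Nat.le_succ l).trans h4, ha, rfl⟩

theorem depth_le_add_dist (hX : (augmentedSpace S C).Connected) (i : ℕ) (x y : AugVertex C) :
    x.depth i ≤ y.depth i + (augmentedSpace S C).dist x y := by
  obtain ⟨w, hw⟩ := hX.exists_walk_length_eq_dist x y
  rw [← hw]
  clear hw
  induction w with
  | nil => simp
  | cons h w ih =>
    have := depth_le_of_adj i h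
    rw [SimpleGraph.Walk.length_cons]
    omega

theorem dist_vertical (S : Set G) {i : ℕ} (p : C i) {m n : ℕ} (h : m ≤ n) :
    (augmentedSpace S C).dist (.pt i (p, m)) (.pt i (p, n)) = n - m :=
  (verticalRay S i p).dist_eq h

theorem dist_horizontal_le (hc : (SimpleGraph.mulCayley S).Connected) {i : ℕ} {p q : C i} {a : ℕ}
    (h : wordDist S p q ≤ 2 ^ a) :
    (augmentedSpace S C).dist (.pt i (p, a)) (.pt i (q, a)) ≤ 1 := by
  by_cases hne : p = q
  · simp [hne]
  · exact dist_le_one_of_adj (adj_horizontal hc hne h)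

end AugmentedSpace

/-! ### Geodesics from the base point and the horoball -/

section Horoball

variable {G : Type*} [Group G] {C : ℕ → Set G} {S : Set G} {D N i : ℕ}

/-- The distance between points at the same high level of a horoball and at the level `N`. -/
theorem dist_apex (hc : (SimpleGraph.mulCayley S).Connected) (g q : C i) {M : ℕ} (hM : N ≤ M)
    (h : wordDist S g q ≤ 2 ^ M) :
    (augmentedSpace S C).dist (.pt i (g, N)) (.pt i (q, M)) ≤ M - N + 1 := by
  have h1 := dist_vertical S g hM
  have h2 := dist_horizontal_le hc h
  have h3 := (connected_augmentedSpace (C := C) hc).dist_triangle (u := .pt i (g, N))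
    (v := .pt i (g, M)) (w := .pt i (q, M))
  omega

/-- Geodesics from the base point to points near the horoball first follow the vertical ray. -/
theorem dist_vertical_le (hc : (SimpleGraph.mulCayley S).Connected)
    (hD : Thin (augmentedSpace S C) D) (g q : C i) {z w : AugVertex C} {a R : ℕ}
    (hz : (augmentedSpace S C).dist z (.pt i (q, a)) ≤ R)
    (hw : Between (augmentedSpace S C) (.pt i (g, N)) w z)
    (h : 2 * (augmentedSpace S C).dist (.pt i (g, N)) w + N + R + 1 ≤
      (augmentedSpace S C).dist (.pt i (g, N)) z + a) :
    (augmentedSpace S C).dist w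
      (.pt i (g, N + (augmentedSpace S C).dist (.pt i (g, N)) w)) ≤ D := by
  set t := (augmentedSpace S C).dist (.pt i (g, N)) w
  have hX := connected_augmentedSpace (C := C) hc
  -- At the height `M` the points over `q` and `g` are equal or adjacent, so `(g, M)` is almost as
  -- close to `z` as the vertical line over `q` allows.
  set M := wordDist S q g + a + N + t
  have h1 : wordDist S q g ≤ 2 ^ M :=
    (Nat.le_of_lt Nat.lt_two_pow_self).trans (Nat.pow_le_pow_right (by norm_num) (by omega))
  have h2 := dist_apex (N := a) hc q g (by omega) h1
  have h3 := hX.dist_triangle (u := z) (v := .pt i (q, a)) (w := .pt i (g, M))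
  have h4 := dist_vertical S g (m := N) (n := N + t) (by omega)
  have h5 := dist_vertical S g (m := N + t) (n := M) (by omega)
  have h6 := dist_vertical S g (m := N) (n := M) (by omega)
  exact hD _ z (.pt i (g, M)) w (.pt i (g, N + t)) hw (by unfold Between; omega)
    (by rw [h4]; omega) (by omega)

/-- Geodesics from the base point to points near the boundary of the horoball run deeply inside the
horoball, except near their end. -/
theorem depth_of_between (hc : (SimpleGraph.mulCayley S).Connected)
    (hD : Thin (augmentedSpace S C) D) (g q : C i) {z w : AugVertex C} {R : ℕ}
    (hz : (augmentedSpace S C).dist z (.pt i (q, 0)) ≤ R)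
    (hw : Between (augmentedSpace S C) (.pt i (g, N)) w z) :
    N + (augmentedSpace S C).dist (.pt i (g, N)) w ≤ w.depth i + D + 1 ∨
      (augmentedSpace S C).dist w z ≤ w.depth i + D + R := by
  have hX := connected_augmentedSpace (C := C) hc
  set e : AugVertex C := .pt i (g, N)
  -- At the height `M` the point `y` over `q` satisfies `d(e, y) ≤ M - N + 1` and `d(z, y) ≤ M + R`.
  -- Since `y` has depth `M`, geodesics from `e` and from `z` to `y` gain depth at unit speed up to
  -- a constant, and `w` is `D`-close to one of the two.
  set M := wordDist S g q + N
  set y : AugVertex C := .pt i (q, M)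
  have h1 : wordDist S g q ≤ 2 ^ M :=
    (Nat.le_of_lt Nat.lt_two_pow_self).trans (Nat.pow_le_pow_right (by norm_num) (by omega))
  have h2 : (augmentedSpace S C).dist e y ≤ M - N + 1 := dist_apex hc g q (by omega) h1
  have h3 := hX.dist_triangle (u := z) (v := .pt i (q, 0)) (w := y)
  have h4 : (augmentedSpace S C).dist (.pt i (q, 0)) y = M - 0 := dist_vertical S q M.zero_le
  have h5 := hX.dist_triangle (u := e) (v := y) (w := z)
  have h6 := hX.dist_triangle (u := e) (v := z) (w := y)
  have h6' := hX.dist_triangle (u := z) (v := e) (w := y)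
  have hw' := hw
  unfold Between at hw
  have hwz := (augmentedSpace S C).dist_comm (u := w) (v := z)
  have hez := (augmentedSpace S C).dist_comm (u := e) (v := z)
  have hyz := (augmentedSpace S C).dist_comm (u := y) (v := z)
  have hyM : y.depth i = M := AugVertex.depth_pt_self _ _
  rcases le_total (2 * (augmentedSpace S C).dist e w + (augmentedSpace S C).dist z y)
    ((augmentedSpace S C).dist e z + (augmentedSpace S C).dist e y) with h | h
  · left
    obtain ⟨v, hv, hv'⟩ := exists_between hX (x := e) (y := y)
      (n := (augmentedSpace S C).dist e w) (by omega)
    have h7 := hD e z y w v hw' hv hv'.symm h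
    have h8 := depth_le_add_dist hX i y v
    have h9 := depth_le_add_dist hX i v w
    rw [(augmentedSpace S C).dist_comm] at h8 h9
    unfold Between at hv
    omega
  · right
    obtain ⟨v, hv, hv'⟩ := exists_between hX (x := z) (y := y)
      (n := (augmentedSpace S C).dist z w) (by omega)
    have h7 := hD z e y w v hw'.symm hv hv'.symm (by omega)
    have h8 := depth_le_add_dist hX i y v
    have h9 := depth_le_add_dist hX i v w
    rw [(augmentedSpace S C).dist_comm] at h8 h9
    unfold Between at hv
    omega

/-- A geodesic leaving a horoball passes through its boundary. -/
theorem exists_between_of_depth (hX : (augmentedSpace S C).Connected) {x y : AugVertex C}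
    (hx : 0 < x.depth i) (hy : y.depth i = 0) :
    ∃ q : C i, Between (augmentedSpace S C) x (.pt i (q, 0)) y := by
  -- A vertex of positive depth has all its neighbours in the same horoball, so the first step of
  -- the geodesic reaches the rim or the induction continues.
  induction hn : (augmentedSpace S C).dist x y using Nat.strong_induction_on generalizing x with
  | _ n ih =>
    have hne : x ≠ y := by rintro rfl; omega
    obtain ⟨z, hz, hz'⟩ := exists_between hX (x := x) (y := y) (n := 1) (hX.pos_dist_of_ne hne)
    obtain ⟨p, hp⟩ := AugVertex.exists_pt_of_depth_pos hx
    have hadj := SimpleGraph.dist_eq_one_iff_adj.1 hz'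
    rw [hp] at hadj
    obtain ⟨q, b, rfl, -⟩ := adj_cases_of_pos hx hadj
    rcases Nat.eq_zero_or_pos b with rfl | hb
    · exact ⟨q, hz⟩
    · have hz2 := hz
      unfold Between at hz2
      obtain ⟨r, hr⟩ := ih ((augmentedSpace S C).dist (.pt i (q, b)) y) (by omega)
        (by simpa using hb) rfl
      exact ⟨r, hz.trans hX hr⟩

/-- The vertex `x` is the end of a walk of length `L` from the base point that stays at levels at
least `N` of the horoball. -/
def DeepWalk (S : Set G) (g : C i) (N L : ℕ) (x : AugVertex C) : Prop :=
  ∃ w : (augmentedSpace S C).Walk (.pt i (g, N)) x, w.length = L ∧ ∀ v ∈ w.support, N ≤ v.depth i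

theorem DeepWalk.concat {g : C i} {L : ℕ} {x y : AugVertex C} (h : DeepWalk S g N L x)
    (hxy : (augmentedSpace S C).Adj x y) (hy : N ≤ y.depth i) : DeepWalk S g N (L + 1) y := by
  obtain ⟨w, hw, hw'⟩ := h
  refine ⟨w.concat hxy, by simp [hw], fun v hv => ?_⟩
  rw [SimpleGraph.Walk.support_concat] at hv
  rcases (by simpa using hv : v ∈ w.support ∨ v = y) with h | rfl
  · exact hw' v h
  · exact hy

/-- Walks inside a horoball can be pushed up to the levels at least `N`. -/
theorem exists_deepWalk (hc : (SimpleGraph.mulCayley S).Connected) (g : C i) {σ : ℕ → AugVertex C}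
    {T : ℕ} (h0 : σ 0 = .pt i (g, N)) (hσ : ∀ t < T, (augmentedSpace S C).Adj (σ t) (σ (t + 1)))
    (hpos : ∀ t < T, 0 < (σ t).depth i) :
    ∃ p a L, σ T = .pt i (p, a) ∧ DeepWalk S g N L (.pt i (p, max a N)) ∧ L + (N - a) ≤ T := by
  -- Each `(p, a)` is moved to `(p, max a N)`. Horizontal edges survive, because higher levels have
  -- more of them, while vertical steps below the level `N` collapse; the truncated difference `N -
  -- a` counts the steps saved.
  induction T with
  | zero =>
    refine ⟨g, N, 0, h0, ?_, by omega⟩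
    rw [max_self]
    exact ⟨.nil, rfl, by simp⟩
  | succ T ih =>
    obtain ⟨p, a, L, h1, h2, h3⟩ := ih (fun t ht => hσ t (by omega)) fun t ht => hpos t (by omega)
    have hadj := hσ T (by omega)
    have ha := hpos T (by omega)
    rw [h1] at hadj ha
    rw [AugVertex.depth_pt_self] at ha
    obtain ⟨q, b, h4, ⟨rfl, h6⟩ | ⟨rfl, h6⟩⟩ := adj_cases_of_pos ha hadj
    · by_cases hpq : p = q
      · exact ⟨q, b, L, h4, hpq ▸ h2, by omega⟩
      · refine ⟨q, b, L + 1, h4, h2.concat (adj_horizontal hc hpq ?_) (by simp), by omega⟩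
        exact h6.trans (Nat.pow_le_pow_right (by norm_num) (le_max_left _ _))
    · rcases Nat.lt_or_ge (max a b) (N + 1) with h | h
      · refine ⟨q, b, L, h4, ?_, by omega⟩
        rwa [show max b N = max a N by omega]
      · refine ⟨q, b, L + 1, h4, h2.concat ?_ (by simp), by omega⟩
        rcases h6 with rfl | rfl
        · rw [show max a N = a by omega, show max (a + 1) N = a + 1 by omega]
          exact vertical_adj S i q a
        · rw [show max (b + 1) N = b + 1 by omega, show max b N = b by omega]
          exact (vertical_adj S i q b).symm

/-- There is a geodesic from the base point to a given point `q` of the boundary of the horoball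
which ends with the vertical segment over `q` below the level `N`, and does not go below the level
`N` before. -/
theorem exists_deepWalk_boundary (hc : (SimpleGraph.mulCayley S).Connected)
    (hD : Thin (augmentedSpace S C) D) (hN : D + 2 ≤ N) (g q : C i) :
    ∃ L, DeepWalk S g N L (.pt i (q, N)) ∧
      L + N ≤ (augmentedSpace S C).dist (.pt i (g, N)) (.pt i (q, 0)) := by
  have hX := connected_augmentedSpace (C := C) hc
  set e : AugVertex C := .pt i (g, N)
  set z : AugVertex C := .pt i (q, 0)
  have hez := depth_le_add_dist hX i e z
  have he : e.depth i = N := AugVertex.depth_pt_self _ _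
  have hz : z.depth i = 0 := AugVertex.depth_pt_self _ _
  obtain ⟨σ, hσ⟩ := exists_isGeodesic hX e z
  set n := (augmentedSpace S C).dist e z
  -- Up to `N - 1` steps before the end, both alternatives of `depth_of_between` give positive
  -- depth; this is where `D + 2 ≤ N` is needed.
  obtain ⟨T, hT⟩ : ∃ T, T + (N - 1) = n := ⟨n - (N - 1), by omega⟩
  have hpos : ∀ t ≤ T, 0 < (σ t).depth i := by
    intro t ht
    have hb := hσ.between (t := t) (by omega)
    have h1 := hσ.dist_start (t := t) (by omega)
    have h2 : (augmentedSpace S C).dist (σ t) z + t = n := by unfold Between at hb; omega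
    have h3 := depth_of_between hc hD g q (z := z) (R := 0) (by simp [z]) hb
    rw [h1] at h3
    omega
  obtain ⟨p, c, L, h1, h2, h3⟩ := exists_deepWalk hc g hσ.1 (T := T) (fun t ht =>
    SimpleGraph.dist_eq_one_iff_adj.1 (hσ.2.2 t 1 (by omega))) (fun t ht => hpos t ht.le)
  have h4 : (augmentedSpace S C).dist (σ T) z = N - 1 := by
    have := hσ.2.2 T (N - 1) (by omega)
    rwa [hT, hσ.2.1] at this
  have h5 := wordDist_proj_add_dist_le (C := C) hc (σ T) z
  rw [h4, h1] at h5
  simp only [z, AugVertex.proj_pt, AugVertex.level_pt, add_zero] at h5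
  have h6 : c ≤ N - 1 :=
    (Nat.pow_le_pow_iff_right (by norm_num : 1 < 2)).1 ((Nat.le_add_left _ _).trans h5)
  rw [show max c N = N by omega] at h2
  by_cases hpq : p = q
  · exact ⟨L, hpq ▸ h2, by omega⟩
  · have h7 : 0 < wordDist S (p : G) q := hc.pos_dist_of_ne fun h => hpq (Subtype.ext h)
    -- If `p ≠ q`, the projection still has to move, so `c` is strictly smaller; this pays for the
    -- additional horizontal edge to `q`.
    have h8 : c < N - 1 := (Nat.pow_lt_pow_iff_right (by norm_num : 1 < 2)).1 (by omega)
    refine ⟨L + 1, h2.concat (adj_horizontal hc hpq ?_) (by simp), by omega⟩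
    exact (Nat.le_of_add_right_le h5).trans (Nat.pow_le_pow_right (by norm_num) (by omega))

theorem Between.dist_add {V : Type*} {Γ : SimpleGraph V} {x u v y : V} (hc : Γ.Connected)
    (h : Between Γ x u y) (h' : Between Γ x v u) : Γ.dist v y = Γ.dist v u + Γ.dist u y := by
  have := h.trans_left hc h'
  unfold Between at *
  omega

/-- Points outside the horoball on a side `[y, a]` of a triangle that are opposite to `[y, e]` are
close to points outside the horoball between `e` and `y`. -/
theorem exists_between_outer (hc : (SimpleGraph.mulCayley S).Connected)
    (hD : Thin (augmentedSpace S C) D) (hN : D + 2 ≤ N) (g : C i) {x y a : AugVertex C}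
    (hx : x.depth i = 0) (hy : y.depth i = 0) (hxy : Between (augmentedSpace S C) y x a)
    (h : 2 * (augmentedSpace S C).dist y x + (augmentedSpace S C).dist (.pt i (g, N)) a ≤
      (augmentedSpace S C).dist y (.pt i (g, N)) + (augmentedSpace S C).dist y a) :
    ∃ w, Between (augmentedSpace S C) (.pt i (g, N)) w y ∧ w.depth i = 0 ∧
      (augmentedSpace S C).dist x w ≤ 2 * D := by
  have hX := connected_augmentedSpace (C := C) hc
  set X := augmentedSpace S C
  set e : AugVertex C := .pt i (g, N)
  have he : e.depth i = N := AugVertex.depth_pt_self _ _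
  -- Among the rim points between `e` and `y`, let `q` be one closest to `y`. All points between `q`
  -- and `y` then have depth `0`.
  have hex : ∃ n, ∃ q : C i, Between X e (.pt i (q, 0)) y ∧ X.dist (.pt i (q, 0)) y = n := by
    obtain ⟨q, hq⟩ := exists_between_of_depth hX (x := e) (i := i) (by omega) hy
    exact ⟨_, q, hq, rfl⟩
  classical
  obtain ⟨q, hq, hqn⟩ := Nat.find_spec hex
  have hmin : ∀ q' : C i, Between X e (.pt i (q', 0)) y →
      X.dist (.pt i (q, 0)) y ≤ X.dist (.pt i (q', 0)) y := by
    intro q' hq'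
    rw [hqn]
    exact Nat.find_min' hex ⟨q', hq', rfl⟩
  clear hqn
  have t1 := hX.dist_triangle (u := y) (v := e) (w := a)
  have t2 := X.dist_comm (u := y) (v := e)
  have t3 := X.dist_comm (u := y) (v := x)
  have close : ∀ w, Between X e w y → X.dist w y = X.dist y x → X.dist x w ≤ D := by
    intro w hw hw'
    exact hD y a e x w hxy hw.symm (by rw [X.dist_comm (u := y) (v := w), hw'])
      (by rw [X.dist_comm (u := a)]; exact h.trans_eq (add_comm _ _))
  rcases le_or_gt (X.dist y x) (X.dist (.pt i (q, 0)) y) with h1 | h1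
  · obtain ⟨w, hw, hw'⟩ := exists_between hX (x := y) (y := .pt i (q, 0)) (n := X.dist y x)
      (by rwa [X.dist_comm (u := y) (v := .pt i (q, 0))])
    have hw2 : Between X e w y := hq.trans hX hw.symm
    rw [X.dist_comm] at hw'
    refine ⟨w, hw2, ?_, (close w hw2 hw').trans (by omega)⟩
    by_contra h2
    obtain ⟨q', hq'⟩ := exists_between_of_depth hX (Nat.pos_of_ne_zero h2) hy
    have h3 := hmin q' (hw2.trans hX hq')
    have h4 : w ≠ .pt i (q', 0) := by
      rintro rfl
      simp at h2
    have h5 := dist_lt_of_between hX hq' h4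
    omega
  -- Here the point opposite to `x` lies before `q`, at distance `r` from it. The geodesic from `e`
  -- to `q` may be taken to be the deep walk `W` followed by the vertical descent over `q`. If `r ≤
  -- N`, the opposite point is `(q, r)`; as `x` has depth `0`, this forces `r ≤ D`, and `q` is
  -- within `2D` of `x`.
  · obtain ⟨L, ⟨W, hW, hWd⟩, hL⟩ := exists_deepWalk_boundary hc hD hN g q
    obtain ⟨r, hr⟩ := Nat.exists_eq_add_of_le h1.le
    have h2 : X.dist e (.pt i (q, N)) ≤ L := hW ▸ SimpleGraph.dist_le W
    have h3 := hX.dist_triangle (u := e) (v := .pt i (q, N)) (w := .pt i (q, 0))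
    have h4 : X.dist (.pt i (q, N)) (.pt i (q, 0)) = N := by
      rw [X.dist_comm]; exact dist_vertical S q N.zero_le
    change L + N ≤ X.dist e (.pt i (q, 0)) at hL
    have h5 : Between X e (.pt i (q, N)) (.pt i (q, 0)) := by unfold Between; omega
    have hq2 := hq
    unfold Between at hq2
    rcases le_or_gt r N with h6 | h6
    · have h7 : X.dist (.pt i (q, r)) (.pt i (q, 0)) = r := by
        rw [X.dist_comm]; exact dist_vertical S q r.zero_le
      have h8 : X.dist (.pt i (q, N)) (.pt i (q, r)) = N - r := by
        rw [X.dist_comm]; exact dist_vertical S q h6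
      have h9 : Between X e (.pt i (q, r)) (.pt i (q, 0)) :=
        h5.trans hX (by unfold Between; omega)
      have h10 := hq.dist_add hX h9
      have h11 := close _ (hq.trans_left hX h9) (by omega)
      have h12 : _ ≤ _ + X.dist _ _ := depth_le_add_dist hX i (.pt i (q, r)) x
      rw [AugVertex.depth_pt_self, X.dist_comm] at h12
      have h13 := hX.dist_triangle (u := x) (v := .pt i (q, r)) (w := .pt i (q, 0))
      dsimp only at h12
      exact ⟨_, hq, by simp, by omega⟩
    -- If `r > N`, the opposite point lies on `W`, so its depth is at least `N > D`; it cannot be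
    -- `D`-close to `x`.
    · exfalso
      obtain ⟨k, hk⟩ : ∃ k, k + r = X.dist e (.pt i (q, 0)) :=
        ⟨X.dist e (.pt i (q, 0)) - r, by omega⟩
      have h7 : IsGeodesic X e (.pt i (q, N)) W.getVert :=
        isGeodesic_of_dist_succ_le_one hX (by simp [e]) (by
          rw [show X.dist e (.pt i (q, N)) = W.length by omega]; simp)
          fun t ht => dist_le_one_of_adj (W.adj_getVert_succ (by omega))
      have h8 := h7.between (t := k) (by omega)
      have h9 := h7.dist_start (t := k) (by omega)
      have h10 := h5.dist_add hX h8
      have h11 := hq.dist_add hX (h5.trans_left hX h8)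
      unfold Between at h8
      have h12 := close _ (hq.trans_left hX (h5.trans_left hX h8)) (by omega)
      have h13 : _ ≤ _ + X.dist _ _ := depth_le_add_dist hX i (W.getVert k) x
      have h14 := hWd _ (W.getVert_mem_support k)
      rw [X.dist_comm] at h13
      omega

theorem not_asymptotic_verticalRay (hX : (augmentedSpace S C).Connected) {m : ℕ} (hm : m ≠ i)
    (p : C i) (q : C m) : ¬ Asymptotic (verticalRay S i p) (verticalRay S m q) := by
  intro h
  obtain ⟨R, hR⟩ := h.exists_dist_le hX
  obtain ⟨n, hn⟩ := hR (R + 1)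
  have := depth_le_add_dist hX i (.pt i (p, R + 1)) (.pt m (q, n))
  rw [AugVertex.depth_pt_self, AugVertex.depth_pt_of_ne hm] at this
  have h2 : (augmentedSpace S C).dist (.pt i (p, R + 1)) (.pt m (q, n)) ≤ R := hn
  dsimp only at this
  omega

/-- A path has to descend `n` levels in one horoball and climb `n` levels in the other, and the
disjoint rims are at least one edge apart. -/
theorem dist_disjoint_horoballs (hc : (SimpleGraph.mulCayley S).Connected) {j m : ℕ}
    (hjm : Disjoint (C j) (C m)) (p : C j) (q : C m) (hpq : wordDist S (p : G) q = 1) {n : ℕ}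
    (hn : 0 < n) : (augmentedSpace S C).dist (.pt j (p, n)) (.pt m (q, n)) = 2 * n + 1 := by
  have hX := connected_augmentedSpace (C := C) hc
  set X := augmentedSpace S C
  have hne : j ≠ m := by
    rintro rfl
    exact Set.disjoint_left.1 hjm p.2 p.2
  apply le_antisymm
  · have h1 : X.dist (.pt j (p, 0)) (.pt j (p, n)) = n := dist_vertical S p n.zero_le
    have h2 : X.dist (.pt m (q, 0)) (.pt m (q, n)) = n := dist_vertical S q n.zero_le
    have h3 : X.dist (.pt j (p, 0)) (.pt m (q, 0)) ≤ 1 := hpq ▸ dist_base_le hc (p : G) q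
    have h4 := hX.dist_triangle (u := .pt j (p, n)) (v := .pt j (p, 0)) (w := .pt m (q, n))
    have h5 := hX.dist_triangle (u := .pt j (p, 0)) (v := .pt m (q, 0)) (w := .pt m (q, n))
    have h6 := X.dist_comm (u := .pt j (p, n)) (v := .pt j (p, 0))
    omega
  · obtain ⟨p', hp'⟩ := exists_between_of_depth (i := j) hX (x := .pt j (p, n))
      (y := .pt m (q, n)) (by simpa using hn) (AugVertex.depth_pt_of_ne hne.symm _)
    obtain ⟨q', hq'⟩ := exists_between_of_depth (i := m) hX (x := .pt m (q, n))
      (y := .pt j (p', 0)) (by simpa using hn) (AugVertex.depth_pt_of_ne hne _)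
    have h1 : _ ≤ _ + X.dist _ _ := depth_le_add_dist hX j (.pt j (p, n)) (.pt j (p', 0))
    have h2 : _ ≤ _ + X.dist _ _ := depth_le_add_dist hX m (.pt m (q, n)) (.pt m (q', 0))
    simp only [AugVertex.depth_pt_self] at h1 h2
    change Between X _ _ _ at hp' hq'
    have h3 : 0 < X.dist (.pt m (q', 0)) (.pt j (p', 0)) := by
      refine hX.pos_dist_of_ne fun h => ?_
      have : (q' : G) = p' := AugVertex.base.inj h
      exact Set.disjoint_left.1 hjm p'.2 (this ▸ q'.2)
    have h4 := X.dist_comm (u := .pt j (p', 0)) (v := .pt m (q, n))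
    unfold Between at hp' hq'
    omega

theorem frequently_exists_mem_finite {ι α : Type*} {f : Filter ι} {B : Set α} (hB : B.Finite)
    {p : α → ι → Prop} (h : ∃ᶠ n in f, ∃ w ∈ B, p w n) : ∃ w ∈ B, ∃ᶠ n in f, p w n := by
  by_contra! h'
  refine h ?_
  have : ∀ᶠ n in f, ∀ w ∈ B, ¬ p w n :=
    (Filter.eventually_all_finite hB).2 fun w hw => h' w hw
  exact this.mono fun n hn ⟨w, hw, hp⟩ => hn w hw hp

/-- A corner at the top of a horoball over `p` of a triangle is either outside the given horoball,
and then the point `x` on the opposite side is close to an outer point, or inside, and then `x` is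
not in the part of the side that is opposite to `e`. -/
theorem exists_between_outer_of_vertical (hc : (SimpleGraph.mulCayley S).Connected)
    (hD : Thin (augmentedSpace S C) D) (hN : D + 2 ≤ N) (g : C i) {x a : AugVertex C} {j : ℕ}
    (p : C j) (hx : x.depth i = 0) {n : ℕ} (hn : wordDist S (g : G) p + N ≤ n)
    (hxy : Between (augmentedSpace S C) (.pt j (p, n)) x a)
    (h : 2 * (augmentedSpace S C).dist (.pt j (p, n)) x +
        (augmentedSpace S C).dist (.pt i (g, N)) a ≤
      (augmentedSpace S C).dist (.pt j (p, n)) (.pt i (g, N)) +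
        (augmentedSpace S C).dist (.pt j (p, n)) a) :
    j ≠ i ∧ ∃ w, Between (augmentedSpace S C) (.pt i (g, N)) w (.pt j (p, n)) ∧ w.depth i = 0 ∧
      (augmentedSpace S C).dist x w ≤ 2 * D := by
  have hX := connected_augmentedSpace (C := C) hc
  by_cases hj : j = i
  -- The corner is within `n - N + 1` of `e`, so points between it and `e` have depth at least `N -
  -- 1 > D`, whereas `x` has depth `0`.
  · exfalso
    subst hj
    set X := augmentedSpace S C
    have h1 : X.dist _ _ ≤ _ := dist_apex (N := N) hc g p (by omega : N ≤ n)
      ((Nat.le_of_add_right_le hn).trans (Nat.le_of_lt Nat.lt_two_pow_self))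
    have h2 := hX.dist_triangle (u := .pt j (p, n)) (v := .pt j (g, N)) (w := a)
    have h3 := X.dist_comm (u := .pt j (p, n)) (v := .pt j (g, N))
    obtain ⟨w, hw, hw'⟩ := exists_between hX (x := .pt j (p, n)) (y := .pt j (g, N))
      (n := X.dist (.pt j (p, n)) x) (by omega)
    have h4 := hD _ a _ x w hxy hw hw'.symm (by rw [X.dist_comm (u := a)]; exact h.trans_eq (add_comm _ _))
    have h5 : _ ≤ _ + X.dist _ _ := depth_le_add_dist hX j (.pt j (p, n)) w
    have h6 : _ ≤ _ + X.dist _ _ := depth_le_add_dist hX j w x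
    rw [X.dist_comm] at h6
    rw [AugVertex.depth_pt_self] at h5
    unfold Between at hw
    dsimp only at h5
    omega
  · exact ⟨hj, exists_between_outer hc hD hN g hx (AugVertex.depth_pt_of_ne hj _) hxy h⟩

/-- Outer points on the vertical lines of the augmented space are close to rays from the base point
to other parabolic points. -/
theorem exists_ray_near (hc : (SimpleGraph.mulCayley S).Connected)
    (hD : Thin (augmentedSpace S C) D)
    (hfin : ∀ x n, {y | (augmentedSpace S C).dist x y ≤ n}.Finite) (hN : D + 2 ≤ N) (g : C i)
    {j m : ℕ} (hjm : Disjoint (C j) (C m)) (p : C j) (q : C m) (hpq : wordDist S (p : G) q = 1)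
    {a : ℕ} (hx : (AugVertex.pt j (p, a)).depth i = 0) :
    ∃ l : GeodesicRay (augmentedSpace S C), l.1 0 = .pt i (g, N) ∧
      ¬ Asymptotic (verticalRay S i g) l ∧
      ∃ t, (l.1 t).depth i = 0 ∧ (augmentedSpace S C).dist (.pt j (p, a)) (l.1 t) ≤ 2 * D := by
  have hX := connected_augmentedSpace (C := C) hc
  set X := augmentedSpace S C
  set x : AugVertex C := .pt j (p, a)
  set e : AugVertex C := .pt i (g, N)
  -- The path down the line over `p`, across an edge and up the line over `q` is a geodesic through
  -- `x`. In the triangle with third corner `e`, the point `x` is opposite to one of the two sides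
  -- at `e`.
  have key : ∀ n, wordDist S (g : G) p + wordDist S (g : G) q + N + a + 1 ≤ n →
      (∃ w ∈ {w | X.dist x w ≤ 2 * D}, j ≠ i ∧ w.depth i = 0 ∧
        Between X e w ((verticalRay S j p).1 n)) ∨
      (∃ w ∈ {w | X.dist x w ≤ 2 * D}, m ≠ i ∧ w.depth i = 0 ∧
        Between X e w ((verticalRay S m q).1 n)) := by
    intro n hn
    have h1 : X.dist (.pt j (p, n)) (.pt m (q, n)) = 2 * n + 1 :=
      dist_disjoint_horoballs hc hjm p q hpq (by omega)
    have h2 : X.dist x (.pt j (p, n)) = n - a := dist_vertical S p (by omega)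
    have h3 : X.dist (.pt j (p, 0)) x = a := dist_vertical S p a.zero_le
    have h4 : X.dist (.pt m (q, 0)) (.pt m (q, n)) = n := dist_vertical S q n.zero_le
    have h5 : X.dist (.pt j (p, 0)) (.pt m (q, 0)) ≤ 1 := hpq ▸ dist_base_le hc (p : G) q
    have h6 := hX.dist_triangle (u := x) (v := .pt j (p, 0)) (w := .pt m (q, n))
    have h7 := hX.dist_triangle (u := .pt j (p, 0)) (v := .pt m (q, 0)) (w := .pt m (q, n))
    have h8 := X.dist_comm (u := x) (v := .pt j (p, 0))
    have h9 := X.dist_comm (u := x) (v := .pt j (p, n))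
    have h10 := X.dist_comm (u := e) (v := .pt j (p, n))
    have h11 := X.dist_comm (u := e) (v := .pt m (q, n))
    have h12 := X.dist_comm (u := x) (v := .pt m (q, n))
    have h13 := X.dist_comm (u := .pt j (p, n)) (v := .pt m (q, n))
    have h14 := hX.dist_triangle (u := .pt j (p, n)) (v := x) (w := .pt m (q, n))
    have hb : Between X (.pt j (p, n)) x (.pt m (q, n)) := by unfold Between; omega
    rcases le_total (2 * X.dist (.pt j (p, n)) x + X.dist e (.pt m (q, n)))
      (X.dist (.pt j (p, n)) e + X.dist (.pt j (p, n)) (.pt m (q, n))) with h | h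
    · obtain ⟨h15, w, hw, hw0, hxw⟩ :=
        exists_between_outer_of_vertical hc hD hN g p hx (by omega) hb h
      exact Or.inl ⟨w, hxw, h15, hw0, hw⟩
    · obtain ⟨h15, w, hw, hw0, hxw⟩ :=
        exists_between_outer_of_vertical hc hD hN g q hx (n := n) (by omega) hb.symm (by
          change 2 * X.dist _ _ + X.dist e _ ≤ X.dist _ e + X.dist _ _
          unfold Between at hb
          omega)
      exact Or.inr ⟨w, hxw, h15, hw0, hw⟩
  have finish : ∀ (j' : ℕ) (p' : C j'), (∃ᶠ n in Filter.atTop, ∃ w ∈ {w | X.dist x w ≤ 2 * D},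
      j' ≠ i ∧ w.depth i = 0 ∧ Between X e w ((verticalRay S j' p').1 n)) →
      ∃ l : GeodesicRay X, l.1 0 = e ∧ ¬ Asymptotic (verticalRay S i g) l ∧
        ∃ t, (l.1 t).depth i = 0 ∧ X.dist x (l.1 t) ≤ 2 * D := by
    intro j' p' h
    obtain ⟨w, hw, hfr⟩ := frequently_exists_mem_finite (hfin x (2 * D)) h
    obtain ⟨n, hn⟩ := hfr.exists
    obtain ⟨l, h1, h2, h3⟩ := exists_ray_asymptotic hX hD hfin (verticalRay S j' p') e w
      (hfr.mono fun n hn => hn.2.2)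
    refine ⟨l, h1, fun h => ?_, _, by rw [h2]; exact hn.2.1, by rw [h2]; exact hw⟩
    exact not_asymptotic_verticalRay hX hn.1 g p' (asymptotic_equivalence.trans h h3)
  -- One of the alternatives holds for infinitely many `n`. Since the ball around `x` is finite, a
  -- single `w` then serves infinitely many `n`, and the limit ray can be made to pass through it.
  have hfreq := (Filter.eventually_atTop.2 ⟨_, key⟩).frequently
  rcases Filter.frequently_or_distrib.1 hfreq with h | h
  · exact finish j p h
  · exact finish m q h

end Horoball

/-! ### Where rays leave the horoball -/

section Exit

variable {G : Type*} [Group G] {C : ℕ → Set G} {S : Set G} {D N i : ℕ}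

/-- The ray is at time `n` at the point `q` of the boundary of the `i`-th horoball, and stays
outside of the horoball from then on. -/
structure ExitsAt (l : GeodesicRay (augmentedSpace S C)) (n : ℕ) (q : C i) : Prop where
  eq : l.1 n = .pt i (q, 0)
  outer : ∀ m, n < m → ∀ p a, l.1 m ≠ .pt i (p, a)

theorem ExitsAt.depth_eq_zero {l : GeodesicRay (augmentedSpace S C)} {n : ℕ} {q : C i}
    (h : ExitsAt l n q) {m : ℕ} (hm : n ≤ m) : (l.1 m).depth i = 0 := by
  rcases hm.eq_or_lt with rfl | hm
  · rw [h.eq, AugVertex.depth_pt_self]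
  · by_contra h0
    obtain ⟨p, hp⟩ := AugVertex.exists_pt_of_depth_pos (Nat.pos_of_ne_zero h0)
    exact h.outer m hm _ _ hp

/-- Rays from the base point that do not end at the parabolic point leave the horoball. -/
theorem exists_exitsAt (hc : (SimpleGraph.mulCayley S).Connected)
    (hD : Thin (augmentedSpace S C) D) (g : C i) {l : GeodesicRay (augmentedSpace S C)}
    (h0 : l.1 0 = .pt i (g, N)) (hl : ¬ Asymptotic l (verticalRay S i g)) :
    ∃ n q, ExitsAt (i := i) l n q := by
  have hX := connected_augmentedSpace (C := C) hc
  -- If the ray met the horoball at arbitrarily late times, then by `dist_vertical_le` it would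
  -- follow the vertical ray forever.
  have hbdd : ∃ B, ∀ n, (∃ q a, l.1 n = .pt i (q, a)) → n ≤ B := by
    by_contra! h
    refine hl (asymptotic_of_dist_le hX (C := D + N) fun t => ?_)
    obtain ⟨n, ⟨q, a, hq⟩, hn⟩ := h (2 * t + N + 1)
    have h1 := l.dist_zero t
    have h2 := l.dist_zero n
    have h3 := l.between (m := t) (n := n) (by omega)
    rw [h0] at h1 h2 h3
    have h4 := dist_vertical_le hc hD g q (R := 0) (a := a) (by rw [hq]; simp) h3
      (by rw [h1, h2]; omega)
    rw [h1] at h4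
    have h5 := hX.dist_triangle (u := l.1 t) (v := .pt i (g, N + t)) (w := .pt i (g, t))
    have h6 := dist_vertical S g (m := t) (n := N + t) (by omega)
    rw [SimpleGraph.dist_comm] at h6
    change (augmentedSpace S C).dist (l.1 t) (.pt i (g, t)) ≤ _
    omega
  obtain ⟨B, hB⟩ := hbdd
  classical
  have hspec := Nat.findGreatest_spec (P := fun n => ∃ q a, l.1 n = .pt i (q, a)) (n := B)
    B.zero_le ⟨g, N, h0⟩
  set n := Nat.findGreatest (fun n => ∃ q a, l.1 n = .pt i (q, a)) B
  have hout : ∀ m, n < m → ∀ p a, l.1 m ≠ .pt i (p, a) := by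
    intro m hm p a hp
    exact absurd (Nat.le_findGreatest (P := fun n => ∃ q a, l.1 n = .pt i (q, a))
      (hB m ⟨p, a, hp⟩) ⟨p, a, hp⟩) (not_le.2 hm)
  obtain ⟨q, a, hq⟩ := hspec
  rcases Nat.eq_zero_or_pos a with rfl | ha
  · exact ⟨n, q, hq, hout⟩
  · exfalso
    have hadj := SimpleGraph.dist_eq_one_iff_adj.1 (l.2 n 1)
    rw [hq] at hadj
    obtain ⟨r, b, h1, -⟩ := adj_cases_of_pos ha hadj
    exact hout (n + 1) (by omega) r b h1

/-- A ray that is near the complement of the horoball at a late time exits soon after. -/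
theorem ExitsAt.le_add (hc : (SimpleGraph.mulCayley S).Connected)
    (hD : Thin (augmentedSpace S C) D) (hN : D + 2 ≤ N) {g : C i}
    {l : GeodesicRay (augmentedSpace S C)} (h0 : l.1 0 = .pt i (g, N)) {n : ℕ} {q : C i}
    (h : ExitsAt l n q) {x : AugVertex C} (hx : x.depth i = 0) {t K : ℕ}
    (hxt : (augmentedSpace S C).dist x (l.1 t) ≤ K) (ht : K + D < t) : n ≤ t + K + D := by
  rcases le_total n t with hnt | hnt
  · omega
  · have h1 := l.between hnt
    have h2 := l.dist_zero t
    rw [h0] at h1 h2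
    have h3 := depth_of_between hc hD g q (R := 0) (by rw [h.eq]; simp) h1
    have h4 := depth_le_add_dist (connected_augmentedSpace (C := C) hc) i (l.1 t) x
    rw [SimpleGraph.dist_comm] at h4
    rw [h2, l.dist_eq hnt] at h3
    omega

/-- The point of `l` at time `n + K + D + 1` is outer and `K`-close to `l'`; the delay `K + D + 1`
makes this time late enough for `ExitsAt.le_add`. -/
theorem ExitsAt.le_add_of_close (hc : (SimpleGraph.mulCayley S).Connected)
    (hD : Thin (augmentedSpace S C) D) (hN : D + 2 ≤ N) {g : C i}
    {l l' : GeodesicRay (augmentedSpace S C)} (h0' : l'.1 0 = .pt i (g, N))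
    {n n' : ℕ} {q q' : C i} (h : ExitsAt l n q) (h' : ExitsAt l' n' q') {K H : ℕ}
    (hK : ∀ t ≤ H, (augmentedSpace S C).dist (l.1 t) (l'.1 t) ≤ K)
    (hH : n + K + D + 1 ≤ H ∨ n' ≤ H) : n' ≤ n + 2 * (K + D) + 1 := by
  by_contra! hlt
  have := h'.le_add hc hD hN h0' (h.depth_eq_zero (m := n + K + D + 1) (by omega))
    (hK (n + K + D + 1) (by omega)) (by omega)
  omega

/-- Fellow travelling rays exit at points that are close to each other. -/
theorem ExitsAt.dist_le (hc : (SimpleGraph.mulCayley S).Connected)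
    (hD : Thin (augmentedSpace S C) D) (hN : D + 2 ≤ N) {g : C i}
    {l l' : GeodesicRay (augmentedSpace S C)} (h0 : l.1 0 = .pt i (g, N))
    (h0' : l'.1 0 = .pt i (g, N))
    {n n' : ℕ} {q q' : C i} (h : ExitsAt l n q) (h' : ExitsAt l' n' q') {K H : ℕ}
    (hK : ∀ t ≤ H, (augmentedSpace S C).dist (l.1 t) (l'.1 t) ≤ K)
    (hH : n + 3 * K + 3 * D + 2 ≤ H ∨ (n ≤ H ∧ n' ≤ H)) :
    (augmentedSpace S C).dist (.pt i (q, 0)) (.pt i (q', 0)) ≤ 3 * K + 2 * D + 1 := by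
  have hX := connected_augmentedSpace (C := C) hc
  -- Under the first alternative of `hH`, this bound on `n'` brings the horizon past `n' + K + D +
  -- 1`, so that the argument can be repeated with the rays exchanged.
  have h1 := h.le_add_of_close hc hD hN h0' h' hK (by omega)
  have h2 := h'.le_add_of_close hc hD hN h0 h (K := K) (H := H)
    (fun t ht => by rw [SimpleGraph.dist_comm]; exact hK t ht) (by omega)
  rw [← h.eq, ← h'.eq]
  rcases le_total n n' with h3 | h3
  · have h4 := hX.dist_triangle (u := l.1 n) (v := l'.1 n) (w := l'.1 n')
    rw [l'.dist_eq h3] at h4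
    have := hK n (by omega)
    omega
  · have h4 := hX.dist_triangle (u := l.1 n) (v := l.1 n') (w := l'.1 n')
    rw [SimpleGraph.dist_comm (u := l.1 n) (v := l.1 n'), l.dist_eq h3] at h4
    have := hK n' (by omega)
    omega

/-- A ray passing near a point of the boundary of the horoball at a late time exits near this
point. -/
theorem ExitsAt.dist_le_of_near (hc : (SimpleGraph.mulCayley S).Connected)
    (hD : Thin (augmentedSpace S C) D) (hN : D + 2 ≤ N) {g : C i}
    {l : GeodesicRay (augmentedSpace S C)} (h0 : l.1 0 = .pt i (g, N)) {n : ℕ} {q : C i}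
    (h : ExitsAt l n q) {p : C i} {t K : ℕ}
    (hpt : (augmentedSpace S C).dist (.pt i (p, 0)) (l.1 t) ≤ K) (ht : K + D < t) :
    (augmentedSpace S C).dist (.pt i (q, 0)) (.pt i (p, 0)) ≤ 2 * K + D := by
  have hX := connected_augmentedSpace (C := C) hc
  have h1 := h.le_add hc hD hN h0 (AugVertex.depth_pt_self _ _) hpt ht
  rw [SimpleGraph.dist_comm] at hpt
  rw [← h.eq]
  have h2 := hX.dist_triangle (u := l.1 n) (v := l.1 t) (w := .pt i (p, 0))
  rcases le_total n t with h3 | h3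
  · have h4 := l.between h3
    have h5 := l.dist_zero n
    rw [h0] at h4 h5
    -- At the exit time the depth is `0`. As `D + 2 ≤ N`, the exit is then not in the climbing part
    -- of the geodesic, hence it is within `K + D` of its end.
    have h6 := depth_of_between hc hD g p hpt h4
    rw [h.depth_eq_zero le_rfl, h5, l.dist_eq h3] at h6
    rw [l.dist_eq h3] at h2
    omega
  · rw [SimpleGraph.dist_comm (u := l.1 n) (v := l.1 t), l.dist_eq h3] at h2
    omega

theorem wordDist_le_of_dist_le (hc : (SimpleGraph.mulCayley S).Connected) {p q : C i} {n : ℕ}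
    (h : (augmentedSpace S C).dist (.pt i (p, 0)) (.pt i (q, 0)) ≤ n) :
    wordDist S (p : G) q ≤ 2 ^ n := by
  have := wordDist_proj_add_dist_le (C := C) hc (.pt i (p, 0)) (.pt i (q, 0))
  simp only [AugVertex.proj_pt, AugVertex.level_pt, add_zero] at this
  exact (Nat.le_of_add_right_le this).trans (Nat.pow_le_pow_right (by norm_num) h)

/-- Rays to the parabolic point are close to the vertical ray. -/
theorem dist_vertical_le_of_asymptotic (hc : (SimpleGraph.mulCayley S).Connected)
    (hD : Thin (augmentedSpace S C) D) {g : C i} {l : GeodesicRay (augmentedSpace S C)}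
    (h0 : l.1 0 = .pt i (g, N)) (hl : Asymptotic l (verticalRay S i g)) (t : ℕ) :
    (augmentedSpace S C).dist (l.1 t) (.pt i (g, N + t)) ≤ D := by
  have hX := connected_augmentedSpace (C := C) hc
  set ρ : GeodesicRay (augmentedSpace S C) := ⟨fun n => .pt i (g, N + n), fun m n => by
    rw [dist_vertical S g (by omega)]; omega⟩
  have h1 : Asymptotic (verticalRay S i g) ρ := by
    refine asymptotic_of_dist_le hX (C := N) fun t => ?_
    change (augmentedSpace S C).dist (.pt i (g, t)) (.pt i (g, N + t)) ≤ N
    rw [dist_vertical S g (by omega)]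
    omega
  exact (asymptotic_equivalence.trans hl h1).dist_le hX hD h0 t

end Exit

/-! ### Cosets and last points -/

section Cosets

variable {G : Type*} [Group G] {k : ℕ} [NeZero k] {P : Fin k → Subgroup G} {g : ℕ → G} {S : Set G}

theorem mem_coset_iff {j : ℕ} {x : G} :
    x ∈ coset P g j ↔ (g j : G ⧸ P (Fin.ofNat k j)) = x := by
  rw [coset, mem_smul_set_iff_inv_smul_mem, smul_eq_mul, SetLike.mem_coe, QuotientGroup.eq]

theorem ofNat_mul_add (r : Fin k) (a : ℕ) : Fin.ofNat k (a * k + r) = r := by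
  ext
  simp [Fin.ofNat, Nat.mul_add_mod_of_lt r.2]

theorem IsCosetOrder.finite_setOf_mem (hg : IsCosetOrder P g) (x : G) :
    {j | x ∈ coset P g j}.Finite := by
  refine Set.Finite.of_finite_image (f := fun j => Fin.ofNat k j) (toFinite _) ?_
  intro j hj j' hj' h
  have hr : ∀ j, j = j / k * k + (Fin.ofNat k j : ℕ) := fun j => by
    simp [Fin.ofNat, Nat.div_add_mod']
  have h1 := mem_coset_iff.1 hj
  have h2 := mem_coset_iff.1 hj'
  dsimp only at h
  rw [← h] at h2
  have := (hg.bijective (Fin.ofNat k j)).1 (a₁ := j / k) (a₂ := j' / k) (by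
    have e1 := hr j
    have e2 := hr j'
    rw [← h] at e2
    dsimp only
    rw [← e1, ← e2, h1, h2])
  rw [hr j, hr j', ← h, this]

theorem IsCosetOrder.exists_mem (hg : IsCosetOrder P g) (r : Fin k) (x : G) :
    ∃ j, Fin.ofNat k j = r ∧ x ∈ coset P g j := by
  obtain ⟨a, ha⟩ := (hg.bijective r).2 x
  refine ⟨a * k + r, ofNat_mul_add r a, mem_coset_iff.2 ?_⟩
  rw [ofNat_mul_add]
  exact ha

/-- Every coset has a disjoint adjacent coset, at each of its points. -/
theorem IsCosetOrder.exists_disjoint (hg : IsCosetOrder P g) (hPindex : ∀ r, (P r).index = 0)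
    (hS : Subgroup.closure S = ⊤) {j : ℕ} (p : coset P g j) :
    ∃ m, Disjoint (coset P g j) (coset P g m) ∧ ∃ q : coset P g m, wordDist S (p : G) q = 1 := by
  set r := Fin.ofNat k j
  -- A subgroup of infinite index is proper, so some generator `s` lies outside it, and `p` and `p *
  -- s` lie in different cosets of the same subgroup.
  obtain ⟨s, hs, hsP⟩ : ∃ s ∈ S, s ∉ P r := by
    by_contra! h
    have h1 : P r = ⊤ := top_le_iff.1 (hS ▸ (Subgroup.closure_le _).2 h)
    have := hPindex r
    rw [h1, Subgroup.index_top] at this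
    exact one_ne_zero this
  obtain ⟨m, hm, hq⟩ := hg.exists_mem r (p * s)
  refine ⟨m, ?_, ⟨p * s, hq⟩, SimpleGraph.dist_eq_one_iff_adj.2
    ((SimpleGraph.mulCayley_adj' S _ _).2 ⟨?_, s, hs, Or.inl rfl⟩)⟩
  · rw [Set.disjoint_left]
    intro x hx hx'
    have h1 := mem_coset_iff.1 hx
    have h2 := mem_coset_iff.1 hx'
    have h3 := mem_coset_iff.1 p.2
    have h4 := mem_coset_iff.1 hq
    rw [hm] at h2 h4
    have h5 : ((p : G) : G ⧸ P r) = ((p * s : G) : G ⧸ P r) := by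
      rw [← h3, ← h4, h2, h1]
    rw [QuotientGroup.eq, inv_mul_cancel_left] at h5
    exact hsP h5
  · intro h
    have h1 : s = 1 := by simpa using h
    exact hsP (h1 ▸ (P r).one_mem)

theorem IsCosetOrder.exists_pt (hg : IsCosetOrder P g) (x : AugVertex (coset P g)) :
    ∃ (j : ℕ) (p : coset P g j) (a : ℕ), x = .pt j (p, a) := by
  rcases x with x | ⟨j, p, l⟩
  · obtain ⟨j, -, hj⟩ := hg.exists_mem 0 x
    exact ⟨j, ⟨x, hj⟩, 0, rfl⟩
  · exact ⟨j, p, l + 1, rfl⟩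

theorem mem_outerVertices_iff {i : ℕ} {x : AugVertex (coset P g)} :
    x ∈ outerVertices P g i ↔ x.depth i = 0 := by
  constructor
  · intro h
    by_contra h0
    obtain ⟨p, hp⟩ := AugVertex.exists_pt_of_depth_pos (Nat.pos_of_ne_zero h0)
    obtain ⟨l, hl⟩ := Nat.exists_eq_succ_of_ne_zero h0
    rw [hl] at hp
    exact h p l hp
  · rintro h p l rfl
    simp [AugVertex.depth] at h

theorem isGreatest_lastTime {i n : ℕ} {l : GeodesicRay (augGraph P g S)} {q : coset P g i}
    (h : ExitsAt l n q) : IsGreatest (visitTimes P g i l.1) (lastTime P g i l.1) ∧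
      lastTime P g i l.1 = n := by
  have h1 : IsGreatest (visitTimes P g i l.1) n := by
    refine ⟨⟨q, h.eq⟩, fun m ⟨p, hp⟩ => ?_⟩
    by_contra hm
    exact h.outer m (not_le.1 hm) p 0 hp
  have h2 : lastTime P g i l.1 = n := h1.csSup_eq
  exact ⟨h2 ▸ h1, h2⟩

theorem ExitsAt.lastPoint {i n : ℕ} {l : GeodesicRay (augGraph P g S)} {q : coset P g i}
    (h : ExitsAt l n q) : ExitsAt l (lastTime P g i l.1) (lastPoint P g i l.1) := by
  have h1 := (isGreatest_lastTime h).2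
  have h2 : ∃ p : coset P g i, l.1 (lastTime P g i l.1) = AugVertex.base (p : G) :=
    ⟨q, by rw [h1]; exact h.eq⟩
  refine ⟨?_, by rw [h1]; exact h.outer⟩
  rw [RelHyp.lastPoint, dif_pos h2]
  exact h2.choose_spec

end Cosets

/-! ### Pullback coarse structures -/

section Coarse

variable {V X Y : Type*}

theorem mem_pullback_ofGraph {Γ : SimpleGraph V} (hc : Γ.Connected) {f : X → V}
    {E : Set (X × X)} : E ∈ ((CoarseStructure.ofGraph Γ).pullback f).controlled ↔
      ∃ R : ℕ, ∀ x y, (x, y) ∈ E → Γ.dist (f x) (f y) ≤ R := by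
  refine exists_congr fun R => ⟨fun h x y hxy => ?_, ?_⟩
  · have := h (f x, f y) ⟨(x, y), hxy, rfl⟩
    rw [← (hc _ _).coe_dist_eq_edist] at this
    exact_mod_cast this
  · rintro h _ ⟨⟨x, y⟩, hxy, rfl⟩
    change Γ.edist (f x) (f y) ≤ R
    rw [← (hc _ _).coe_dist_eq_edist]
    exact_mod_cast h x y hxy

theorem mem_pullback_pullback_ofGraph {Γ : SimpleGraph V} (hc : Γ.Connected) {f : X → V}
    {h : Y → X} {E : Set (Y × Y)} :
    E ∈ (((CoarseStructure.ofGraph Γ).pullback f).pullback h).controlled ↔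
      ∃ R : ℕ, ∀ x y, (x, y) ∈ E → Γ.dist (f (h x)) (f (h y)) ≤ R := by
  refine (mem_pullback_ofGraph hc (E := Prod.map h h '' E)).trans (exists_congr fun R => ?_)
  constructor
  · exact fun H x y hxy => H _ _ ⟨(x, y), hxy, rfl⟩
  · rintro H _ _ ⟨⟨x, y⟩, hxy, hx⟩
    obtain ⟨rfl, rfl⟩ := Prod.mk.inj hx
    exact H x y hxy

/-- A coarsely surjective map is a coarse equivalence for the pullback structure. -/
theorem coarselyEquivalent_pullback (𝓕 : CoarseStructure X) (L : Y → X) (h : X → Y)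
    (hL : 𝓕.Close (L ∘ h) id) : (𝓕.pullback L).CoarselyEquivalent 𝓕 := by
  have hL' := 𝓕.inv _ hL
  have image : ∀ E ∈ 𝓕.controlled, Prod.map (L ∘ h) (L ∘ h) '' E ∈ 𝓕.controlled := by
    intro E hE
    refine 𝓕.subset _ (𝓕.comp _ hL _ (𝓕.comp _ hE _ hL')) _ ?_
    rintro _ ⟨⟨x, y⟩, hxy, rfl⟩
    exact ⟨x, ⟨x, rfl⟩, y, hxy, ⟨y, rfl⟩⟩
  refine ⟨L, h, ⟨fun B hB => ?_, fun E hE => hE⟩, ⟨fun B hB => ?_, fun E hE => ?_⟩, ?_, hL⟩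
  · refine 𝓕.subset _ hB _ ?_
    rintro _ ⟨⟨x, y⟩, ⟨hx, hy⟩, rfl⟩
    exact ⟨hx, hy⟩
  · refine 𝓕.subset _ (𝓕.comp _ hL' _ (𝓕.comp _ hB _ hL)) _ ?_
    rintro ⟨x, y⟩ ⟨hx, hy⟩
    exact ⟨L (h x), ⟨x, rfl⟩, L (h y), ⟨(h x, h y), ⟨hx, hy⟩, rfl⟩, ⟨y, rfl⟩⟩
  · change Prod.map L L '' (Prod.map h h '' E) ∈ 𝓕.controlled
    rw [← image_comp]
    exact image E hE
  · refine 𝓕.subset _ hL _ ?_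
    rintro _ ⟨_, ⟨u, rfl⟩, rfl⟩
    exact ⟨L u, rfl⟩

end Coarse

/-! ### The coarse structure on the punctured boundary -/

section PuncturedBoundary

variable {G : Type*} [Group G] {k : ℕ} [NeZero k] {P : Fin k → Subgroup G} {g : ℕ → G} {S : Set G}
  {D N i : ℕ}

theorem endpoint_ne_parabolicPoint_iff {l : GeodesicRay (augGraph P g S)} :
    l.endpoint ≠ parabolicPoint P g S i ↔
      ¬ Asymptotic l (verticalRay S i (cosetRep P g i)) :=
  not_congr endpoint_eq_iff

theorem RayTo.exitsAt (hc : (SimpleGraph.mulCayley S).Connected)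
    (hD : Thin (augGraph P g S) D) {u : PuncturedBoundary P g S i} (l : RayTo P g S i N u.1) :
    ExitsAt l.1 (lastTime P g i l.1.1) (lastPoint P g i l.1.1) := by
  obtain ⟨n, q, h⟩ := exists_exitsAt hc hD (cosetRep P g i) l.2.1
    (endpoint_ne_parabolicPoint_iff.1 (by rw [l.2.2]; exact u.2))
  exact h.lastPoint

/-- Vertices outside the horoball are close to rays from the base point. -/
theorem exists_ray_near_outer (hg : IsCosetOrder P g) (hPindex : ∀ r, (P r).index = 0)
    (hS : Subgroup.closure S = ⊤) (hD : Thin (augGraph P g S) D)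
    (hfin : ∀ x n, {y | (augGraph P g S).dist x y ≤ n}.Finite) (hN : D + 2 ≤ N)
    {x : AugVertex (coset P g)} (hx : x.depth i = 0) :
    ∃ l : GeodesicRay (augGraph P g S), l.1 0 = basePoint P g i N ∧
      l.endpoint ≠ parabolicPoint P g S i ∧
      ∃ t, (l.1 t).depth i = 0 ∧ (augGraph P g S).dist x (l.1 t) ≤ 2 * D := by
  obtain ⟨j, p, a, rfl⟩ := hg.exists_pt x
  obtain ⟨m, hjm, q, hpq⟩ := hg.exists_disjoint hPindex hS p
  obtain ⟨l, h1, h2, h3⟩ := exists_ray_near (connected_mulCayley hS) hD hfin hN (cosetRep P g i)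
    hjm p q hpq hx
  exact ⟨l, h1, endpoint_ne_parabolicPoint_iff.2 fun h => h2 (asymptotic_equivalence.symm h), h3⟩

variable (lu : ∀ u : PuncturedBoundary P g S i, RayTo P g S i N u.1)

theorem mem_puncturedCoarse_iff (hc : (SimpleGraph.mulCayley S).Connected)
    {E : Set (PuncturedBoundary P g S i × PuncturedBoundary P g S i)} :
    E ∈ (puncturedCoarse lu).controlled ↔
      ∃ R : ℕ, ∀ u v, (u, v) ∈ E → wordDist S (mapL lu u : G) (mapL lu v) ≤ R :=
  mem_pullback_pullback_ofGraph hc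

/-- If all rays from `e_i` to `v` follow `l^u` well beyond its exit time, then the last points for
`u` and `v` are at bounded distance. The horizon `T` is the one that `ExitsAt.dist_le` requires for
`K = D`. -/
theorem exists_controlled_nhds (hS : Subgroup.closure S = ⊤) (hD : Thin (augGraph P g S) D)
    (hfin : ∀ x n, {y | (augGraph P g S).dist x y ≤ n}.Finite) (hN : D + 2 ≤ N) :
    ∃ E ∈ (puncturedCoarse lu).controlled, E ∈ 𝓝ˢ (diagonal (PuncturedBoundary P g S i)) := by
  have hc := connected_mulCayley hS
  have hX : (augGraph P g S).Connected := connected_augmentedSpace hc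
  set K := 2 ^ (3 * D + 2 * D + 1)
  refine ⟨{x | wordDist S (mapL lu x.1 : G) (mapL lu x.2) ≤ K + K},
    (mem_puncturedCoarse_iff lu hc).2 ⟨K + K, fun u v h => h⟩, ?_⟩
  rw [mem_nhdsSet_iff_forall]
  rintro ⟨u, v⟩ huv
  obtain rfl : u = v := huv
  set T := lastTime P g i (lu u).1.1 + 3 * D + 3 * D + 2
  set O : Set (PuncturedBoundary P g S i) := {v | ∀ l : GeodesicRay (augGraph P g S),
    l.1 0 = basePoint P g i N → l.endpoint = v.1 →
      ∀ t ≤ T, (augGraph P g S).dist (l.1 t) ((lu u).1.1 t) ≤ D}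
  have hO : IsOpen O := (isOpen_setOf_dist_le hX hD hfin (basePoint P g i N) (lu u).1.1 D T).preimage
    continuous_subtype_val
  have huO : u ∈ O := fun l h1 h2 t _ =>
    (endpoint_eq_iff.1 (h2.trans (lu u).2.2.symm)).dist_le hX hD (h1.trans (lu u).2.1.symm) t
  have hclose : ∀ v ∈ O, wordDist S (mapL lu u : G) (mapL lu v) ≤ K := by
    intro v hv
    refine wordDist_le_of_dist_le hc (((lu u).exitsAt hc hD).dist_le hc hD hN (lu u).2.1 (lu v).2.1
      ((lu v).exitsAt hc hD) (K := D) (H := T) (fun t ht => ?_) (Or.inl le_rfl))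
    rw [SimpleGraph.dist_comm]
    exact hv _ (lu v).2.1 (lu v).2.2 t ht
  refine Filter.mem_of_superset (prod_mem_nhds (hO.mem_nhds huO) (hO.mem_nhds huO)) ?_
  rintro ⟨v, w⟩ ⟨hv, hw⟩
  have h1 := hclose v hv
  rw [wordDist, SimpleGraph.dist_comm] at h1
  exact hc.dist_triangle.trans (add_le_add h1 (hclose w hw))

/-- Exit times on a bounded set are at most `T`. A ray following the vertical ray up to time `T`
would still be deep in the horoball when it exits, so the set avoids a neighbourhood of `s_i`, whose
complement is compact. -/
theorem isCompact_closure_of_isBounded (hS : Subgroup.closure S = ⊤)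
    (hD : Thin (augGraph P g S) D) (hfin : ∀ x n, {y | (augGraph P g S).dist x y ≤ n}.Finite)
    (hN : D + 2 ≤ N) {B : Set (PuncturedBoundary P g S i)} (hB : (puncturedCoarse lu).IsBounded B) :
    IsCompact (closure B) := by
  have hc := connected_mulCayley hS
  have hX : (augGraph P g S).Connected := connected_augmentedSpace hc
  have := compactSpace_boundary hX hD hfin
  rcases B.eq_empty_or_nonempty with rfl | ⟨u₀, hu₀⟩
  · simp
  obtain ⟨R, hR⟩ := (mem_puncturedCoarse_iff lu hc).1 hB
  set T := lastTime P g i (lu u₀).1.1 + R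
  set O : Set (GromovBoundary (augGraph P g S)) := {v | ∀ l : GeodesicRay (augGraph P g S),
    l.1 0 = basePoint P g i N → l.endpoint = v → ∀ t ≤ T,
      (augGraph P g S).dist (l.1 t) (AugVertex.pt i (cosetRep P g i, N + t)) ≤ D}
  have hO : IsOpen O := isOpen_setOf_dist_le hX hD hfin (basePoint P g i N)
    (fun t => AugVertex.pt i (cosetRep P g i, N + t)) D T
  have hpO : parabolicPoint P g S i ∈ O := fun l h1 h2 t _ =>
    dist_vertical_le_of_asymptotic hc hD h1 (endpoint_eq_iff.1 h2) t
  have hBO : B ⊆ Subtype.val ⁻¹' Oᶜ := by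
    intro u hu huO
    have hex := (lu u).exitsAt hc hD
    have hex₀ := (lu u₀).exitsAt hc hD
    have h1 := (lu u).1.dist_zero (lastTime P g i (lu u).1.1)
    have h2 := (lu u₀).1.dist_zero (lastTime P g i (lu u₀).1.1)
    rw [hex.eq, (lu u).2.1] at h1
    rw [hex₀.eq, (lu u₀).2.1] at h2
    have h3 : (augGraph P g S).dist (.pt i (lastPoint P g i (lu u₀).1.1, 0))
        (.pt i (lastPoint P g i (lu u).1.1, 0)) ≤ R :=
      (dist_base_le hc _ _).trans (hR u₀ u ⟨hu₀, hu⟩)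
    have h4 := hX.dist_triangle (u := basePoint P g i N)
      (v := .pt i (lastPoint P g i (lu u₀).1.1, 0)) (w := .pt i (lastPoint P g i (lu u).1.1, 0))
    have h5 := huO (lu u).1 (lu u).2.1 (lu u).2.2 (lastTime P g i (lu u).1.1) (by omega)
    have h6 : _ ≤ _ + (augGraph P g S).dist _ _ := depth_le_add_dist hX i
      (.pt i (cosetRep P g i, N + lastTime P g i (lu u).1.1))
      ((lu u).1.1 (lastTime P g i (lu u).1.1))
    rw [AugVertex.depth_pt_self, hex.depth_eq_zero le_rfl, SimpleGraph.dist_comm] at h6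
    dsimp only at h6
    omega
  have hK : IsCompact (Subtype.val ⁻¹' Oᶜ : Set (PuncturedBoundary P g S i)) := by
    refine Topology.IsEmbedding.subtypeVal.isCompact_iff.2 ?_
    convert hO.isClosed_compl.isCompact using 1
    ext u
    exact ⟨fun ⟨v, hv, hvu⟩ => hvu ▸ hv, fun hu => ⟨⟨u, fun h => hu (h ▸ hpO)⟩, hu, rfl⟩⟩
  exact hK.of_isClosed_subset isClosed_closure
    (closure_minimal hBO (hO.isClosed_compl.preimage continuous_subtype_val))

theorem isProperSpace_puncturedCoarse (hS : Subgroup.closure S = ⊤)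
    (hD : Thin (augGraph P g S) D) (hfin : ∀ x n, {y | (augGraph P g S).dist x y ≤ n}.Finite)
    (hN : D + 2 ≤ N) : (puncturedCoarse lu).IsProperSpace := by
  have hc := connected_mulCayley hS
  have hX : (augGraph P g S).Connected := connected_augmentedSpace hc
  have := compactSpace_boundary hX hD hfin
  have := t2Space_boundary hX hD hfin
  have := secondCountable_boundary hX hD hfin
  refine ⟨?_, Topology.IsEmbedding.subtypeVal.secondCountableTopology, inferInstance, exists_controlled_nhds lu hS hD hfin hN,
    fun B hB => isCompact_closure_of_isBounded lu hS hD hfin hN hB, fun u v => ?_⟩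
  · exact IsOpen.locallyCompactSpace isOpen_ne
  · refine (mem_puncturedCoarse_iff lu hc).2 ⟨wordDist S (mapL lu u : G) (mapL lu v), ?_⟩
    rintro _ _ ⟨rfl, rfl⟩
    exact le_rfl

/-- Exchanges an arbitrary ray for the chosen ray `l^u`, at the cost of `D`. -/
theorem dist_rayTo_le (hX : (augGraph P g S).Connected) (hD : Thin (augGraph P g S) D)
    {u : PuncturedBoundary P g S i} {l : GeodesicRay (augGraph P g S)}
    (h0 : l.1 0 = basePoint P g i N) (h : l.endpoint = u.1) {x : AugVertex (coset P g)} {t K : ℕ}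
    (hx : (augGraph P g S).dist x (l.1 t) ≤ K) :
    (augGraph P g S).dist x ((lu u).1.1 t) ≤ K + D :=
  hX.dist_triangle.trans (add_le_add hx
    ((endpoint_eq_iff.1 (h.trans (lu u).2.2.symm)).dist_le hX hD (h0.trans (lu u).2.1.symm) t))

theorem coarselyEquivalent_puncturedCoarse (hg : IsCosetOrder P g)
    (hPindex : ∀ r, (P r).index = 0) (hS : Subgroup.closure S = ⊤)
    (hD : Thin (augGraph P g S) D) (hfin : ∀ x n, {y | (augGraph P g S).dist x y ≤ n}.Finite)
    (hN : D + 2 ≤ N) : (puncturedCoarse lu).CoarselyEquivalent (cosetCoarse P g S i) := by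
  have hc := connected_mulCayley hS
  have hX : (augGraph P g S).Connected := connected_augmentedSpace hc
  have hray : ∀ q : coset P g i, ∃ u : PuncturedBoundary P g S i, ∃ t,
      (augGraph P g S).dist (.pt i (q, 0)) ((lu u).1.1 t) ≤ 2 * D + D := by
    intro q
    obtain ⟨l, h1, h2, t, -, h4⟩ := exists_ray_near_outer (i := i) hg hPindex hS hD hfin hN
      (x := .pt i (q, 0)) (AugVertex.depth_pt_self _ _)
    exact ⟨⟨_, h2⟩, t, dist_rayTo_le lu hX hD h1 rfl h4⟩
  choose h t ht using hray
  have hF : {q : coset P g i |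
      (augGraph P g S).dist (basePoint P g i N) (.pt i (q, 0)) ≤ 7 * D}.Finite :=
    (hfin (basePoint P g i N) (7 * D)).preimage (f := fun q : coset P g i => AugVertex.pt i (q, 0))
      fun p _ q _ hpq => (Prod.mk.inj (AugVertex.pt_injective i hpq)).1
  obtain ⟨Q, hQ⟩ := (hF.image fun q => wordDist S (mapL lu (h q) : G) q).bddAbove
  refine coarselyEquivalent_pullback _ _ h
    ((mem_pullback_ofGraph hc).2 ⟨max Q (2 ^ (2 * (2 * D + D) + D)), ?_⟩)
  rintro _ _ ⟨q, hq⟩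
  obtain ⟨rfl, rfl⟩ := Prod.mk.inj hq
  change wordDist S (mapL lu (h q) : G) q ≤ _
  -- `ExitsAt.dist_le_of_near` with `K = 3D` needs a time later than `4D`. Earlier times occur only
  -- for `q` within `7D` of `e_i`, and these finitely many points are absorbed into `Q`.
  rcases le_or_gt (t q) (4 * D) with h1 | h1
  · refine le_trans (hQ ⟨q, ?_, rfl⟩) (le_max_left _ _)
    have h2 := (lu (h q)).1.dist_zero (t q)
    rw [(lu (h q)).2.1] at h2
    have h3 := hX.dist_triangle (u := basePoint P g i N) (v := (lu (h q)).1.1 (t q))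
      (w := .pt i (q, 0))
    have h4 := ht q
    rw [SimpleGraph.dist_comm] at h4
    change (augGraph P g S).dist _ _ ≤ _
    omega
  · refine le_trans (wordDist_le_of_dist_le hc ?_) (le_max_right _ _)
    exact ((lu (h q)).exitsAt hc hD).dist_le_of_near hc hD hN (lu (h q)).2.1 (ht q) (by omega)

/-- The last points of two rays passing near outer points `x` and `y` at late times are at a
distance bounded in terms of the distance of `x` and `y`. -/
theorem wordDist_mapL_le (hc : (SimpleGraph.mulCayley S).Connected)
    (hD : Thin (augGraph P g S) D) (hN : D + 2 ≤ N) {u v : PuncturedBoundary P g S i}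
    {x y : AugVertex (coset P g)} (hx : x.depth i = 0) (hy : y.depth i = 0) {s t κ R : ℕ}
    (hxs : (augGraph P g S).dist x ((lu u).1.1 s) ≤ κ)
    (hyt : (augGraph P g S).dist y ((lu v).1.1 t) ≤ κ)
    (hR : (augGraph P g S).dist ((lu u).1.1 s) ((lu v).1.1 t) ≤ R)
    (hs : κ + D < s) (ht : κ + D < t) :
    wordDist S (mapL lu u : G) (mapL lu v) ≤ 2 ^ (3 * (2 * (R + κ + D) + R + D) + 2 * D + 1) := by
  have hX : (augGraph P g S).Connected := connected_augmentedSpace hc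
  have hu := (lu u).exitsAt hc hD
  have hv := (lu v).exitsAt hc hD
  have h1 := hu.le_add hc hD hN (lu u).2.1 hx hxs hs
  have h2 := hv.le_add hc hD hN (lu v).2.1 hy hyt ht
  have h0 : (lu u).1.1 0 = (lu v).1.1 0 := (lu u).2.1.trans (lu v).2.1.symm
  have h3 : s ≤ t + R ∧ t ≤ s + R := by
    have a1 := (lu u).1.dist_zero s
    have a2 := (lu v).1.dist_zero t
    have a3 := hX.dist_triangle (u := (lu u).1.1 0) (v := (lu u).1.1 s) (w := (lu v).1.1 t)
    have a4 := hX.dist_triangle (u := (lu u).1.1 0) (v := (lu v).1.1 t) (w := (lu u).1.1 s)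
    have a5 := (augGraph P g S).dist_comm (u := (lu u).1.1 s) (v := (lu v).1.1 t)
    rw [← h0] at a2
    omega
  -- The horizon covers both exit times, because `s` and `t` differ by at most `R`. Up to about that
  -- time the rays are `D`-close by thinness; afterwards all times involved are within `R + κ + D`
  -- of `s` and of `t`.
  refine wordDist_le_of_dist_le hc (hu.dist_le hc hD hN (lu u).2.1 (lu v).2.1 hv
    (H := min s t + R + κ + D) (fun r hr => ?_) (Or.inr ⟨by omega, by omega⟩))
  change (augGraph P g S).dist _ _ ≤ _
  rcases le_or_gt (2 * r + R) (s + t) with h4 | h4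
  · have := dist_le_of_ray hX hD h0 (m := s) (n := t) (t := r) (by omega)
    omega
  · have a1 := hX.dist_triangle (u := (lu u).1.1 r) (v := (lu u).1.1 s) (w := (lu v).1.1 t)
    have a2 := hX.dist_triangle (u := (lu u).1.1 r) (v := (lu v).1.1 t) (w := (lu v).1.1 r)
    have a3 : (augGraph P g S).dist ((lu u).1.1 r) ((lu u).1.1 s) ≤ R + κ + D := by
      rcases le_total r s with h | h
      · rw [(lu u).1.dist_eq h]; omega
      · rw [SimpleGraph.dist_comm, (lu u).1.dist_eq h]; omega
    have a4 : (augGraph P g S).dist ((lu v).1.1 t) ((lu v).1.1 r) ≤ R + κ + D := by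
      rcases le_total t r with h | h
      · rw [(lu v).1.dist_eq h]; omega
      · rw [SimpleGraph.dist_comm, (lu v).1.dist_eq h]; omega
    omega

theorem isHigson_comp_mapF (hS : Subgroup.closure S = ⊤)
    (hD : Thin (augGraph P g S) D) (hfin : ∀ x n, {y | (augGraph P g S).dist x y ≤ n}.Finite)
    (hN : D + 2 ≤ N) {δ : ℝ} (lx : ∀ x : outerVertices P g i, RayNear P g S i N δ x.1)
    {f : PuncturedBoundary P g S i → ℂ} (hf : (puncturedCoarse lu).IsHigson f) :
    (outerCoarse P g S i).IsHigson (f ∘ mapF lx) := by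
  have hc := connected_mulCayley hS
  have hX : (augGraph P g S).Connected := connected_augmentedSpace hc
  have : DiscreteTopology (AugVertex (coset P g)) := ⟨rfl⟩
  obtain ⟨M, hM⟩ := hf.bounded
  refine ⟨continuous_of_discreteTopology, ⟨M, fun x => hM _⟩, fun E hE ε hε => ?_⟩
  obtain ⟨R₀, hR₀⟩ := (mem_pullback_ofGraph hX).1 hE
  set e := basePoint P g i N
  set κ := ⌊2 * δ⌋₊ + D
  set R := R₀ + 2 * κ
  have hnear : ∀ x : outerVertices P g i,
      (augGraph P g S).dist x.1 ((lu (mapF lx x)).1.1 (lx x).time) ≤ κ := fun x =>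
    dist_rayTo_le lu hX hD (lx x).start rfl (Nat.le_floor (lx x).near)
  have htime : ∀ x : outerVertices P g i, (augGraph P g S).dist e x.1 ≤ (lx x).time + κ := by
    intro x
    have h1 := (lu (mapF lx x)).1.dist_zero (lx x).time
    rw [(lu (mapF lx x)).2.1] at h1
    have h2 := hX.dist_triangle (u := e) (v := (lu (mapF lx x)).1.1 (lx x).time) (w := x.1)
    have h3 := hnear x
    rw [SimpleGraph.dist_comm] at h3
    change (augGraph P g S).dist e _ = _ at h1
    omega
  set Q := 2 ^ (3 * (2 * (R + κ + D) + R + D) + 2 * D + 1)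
  obtain ⟨B, hB, hfB⟩ := hf.vanishing {x | wordDist S (mapL lu x.1 : G) (mapL lu x.2) ≤ Q}
    ((mem_puncturedCoarse_iff lu hc).2 ⟨Q, fun u v h => h⟩) ε hε
  have hK := isCompact_closure_of_isBounded lu hS hD hfin hN hB
  obtain ⟨T, hT⟩ := exists_forall_norm_sub_lt hX hD hfin e hf.continuous hK hε D
  -- If one of `x`, `y` is farther than `A` from `e`, then both times exceed `T + κ + D + R`, which
  -- suffices in either case below.
  set A := T + R + R₀ + κ + κ + D
  refine ⟨{x | (augGraph P g S).dist e x.1 ≤ A}, ?_, ?_⟩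
  · refine (mem_pullback_ofGraph hX).2 ⟨A + A, ?_⟩
    rintro x y ⟨hx, hy⟩
    rw [mem_ofPred_eq, SimpleGraph.dist_comm] at hx
    exact hX.dist_triangle.trans (add_le_add hx hy)
  · rintro x y ⟨hxy, hout⟩
    have hd := hR₀ x y hxy
    have hfar : A < (augGraph P g S).dist e x.1 ∨ A < (augGraph P g S).dist e y.1 := by
      by_contra! h
      exact hout ⟨h.1, h.2⟩
    have h1 := htime x
    have h2 := htime y
    have h3 := hX.dist_triangle (u := e) (v := x.1) (w := y.1)
    have h4 := hX.dist_triangle (u := e) (v := y.1) (w := x.1)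
    rw [SimpleGraph.dist_comm (u := y.1)] at h4
    have h5 : T + κ + D + R < (lx x).time ∧ T + κ + D + R < (lx y).time := by
      omega
    have h6 : (augGraph P g S).dist ((lu (mapF lx x)).1.1 (lx x).time)
        ((lu (mapF lx y)).1.1 (lx y).time) ≤ R := by
      have a1 := hX.dist_triangle (u := (lu (mapF lx x)).1.1 (lx x).time) (v := x.1)
        (w := (lu (mapF lx y)).1.1 (lx y).time)
      have a2 := hX.dist_triangle (u := x.1) (v := y.1)
        (w := (lu (mapF lx y)).1.1 (lx y).time)
      have a3 := hnear x
      have a4 := hnear y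
      rw [SimpleGraph.dist_comm] at a3
      omega
    -- Inside `B × B` the rays are `D`-close up to time `T`, and uniform continuity on the compact
    -- closure of `B` applies. Otherwise the last points are within `Q`, and the vanishing variation
    -- of `f` applies.
    by_cases hBB : (mapF lx x, mapF lx y) ∈ B ×ˢ B
    · refine hT _ (subset_closure hBB.1) _ (subset_closure hBB.2) (lu (mapF lx x)).1
        (lu (mapF lx y)).1 (lu _).2.1 (lu _).2.1 (lu _).2.2 (lu _).2.2 fun t ht => ?_
      exact dist_le_of_ray hX hD ((lu (mapF lx x)).2.1.trans (lu (mapF lx y)).2.1.symm)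
        (m := (lx x).time) (n := (lx y).time) (by
          omega)
    · refine hfB _ _ ⟨?_, hBB⟩
      exact wordDist_mapL_le lu hc hD hN (mem_outerVertices_iff.1 x.2)
        (mem_outerVertices_iff.1 y.2) (hnear x) (hnear y) h6 (by omega) (by omega)

end PuncturedBoundary

end RelHyp

theorem proposition8 {G : Type*} [Group G] {k : ℕ} [NeZero k] (P : Fin k → Subgroup G)
    (hP : ∀ r, Infinite (P r)) (hPindex : ∀ r, (P r).index = 0)
    (S : Set G) (hSfin : S.Finite) (hSinv : S⁻¹ = S) (hSgen : Subgroup.closure S = ⊤)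
    (g : ℕ → G) (hg : IsCosetOrder P g)
    (δ : ℝ) (hδ : 0 < δ) (hthin : ThinTriangles (augGraph P g S) δ)
    (N : ℕ) (hN : δ + 1 < N) (i : ℕ) :
    (∀ u : PuncturedBoundary P g S i, Nonempty (RayTo P g S i N u.1)) ∧
    (∀ x : outerVertices P g i, Nonempty (RayNear P g S i N δ x.1)) ∧
    ∀ lu : (∀ u : PuncturedBoundary P g S i, RayTo P g S i N u.1),
      (∀ u, IsGreatest (visitTimes P g i (lu u).1.1) (lastTime P g i (lu u).1.1) ∧
        (lu u).1.1 (lastTime P g i (lu u).1.1) = AugVertex.base (mapL lu u : G)) ∧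
      (puncturedCoarse lu).IsProperSpace ∧
      (puncturedCoarse lu).CoarselyEquivalent (cosetCoarse P g S i) ∧
      ∀ (lx : ∀ x : outerVertices P g i, RayNear P g S i N δ x.1)
        (f : PuncturedBoundary P g S i → ℂ), (puncturedCoarse lu).IsHigson f →
          (outerCoarse P g S i).IsHigson (f ∘ mapF lx) := by
  have hc := connected_mulCayley hSgen
  have hX : (augGraph P g S).Connected := connected_augmentedSpace hc
  have hD := hthin.thin hX
  have hfin : ∀ x n, {y | (augGraph P g S).dist x y ≤ n}.Finite :=
    finite_ball_augmentedSpace hSfin hSgen hg.finite_setOf_mem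
  have hfl : (⌊δ⌋₊ : ℝ) ≤ δ := Nat.floor_le hδ.le
  -- Integrality turns the strict inequality `δ + 1 < N` into the margin used throughout.
  have hDN : ⌊δ⌋₊ + 2 ≤ N := by
    have : ((⌊δ⌋₊ + 1 : ℕ) : ℝ) < N := by push_cast; linarith
    exact_mod_cast this
  refine ⟨fun u => ?_, fun x => ?_, fun lu => ⟨fun u => ?_,
    isProperSpace_puncturedCoarse lu hSgen hD hfin hDN,
    coarselyEquivalent_puncturedCoarse lu hg hPindex hSgen hD hfin hDN,
    fun lx f hf => isHigson_comp_mapF lu hSgen hD hfin hDN lx hf⟩⟩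
  · obtain ⟨l, h1, h2⟩ := exists_ray_endpoint hX hD hfin (basePoint P g i N) u.1
    exact ⟨⟨l, h1, h2⟩⟩
  · obtain ⟨l, h1, h2, t, h3, h4⟩ := exists_ray_near_outer (i := i) hg hPindex hSgen hD hfin hDN
      (mem_outerVertices_iff.1 x.2)
    refine ⟨⟨l, t, h1, h2, mem_outerVertices_iff.2 h3, ?_⟩⟩
    have : ((augGraph P g S).dist x.1 (l.1 t) : ℝ) ≤ 2 * ⌊δ⌋₊ := by exact_mod_cast h4
    linarith
  · have h := (lu u).exitsAt hc hD
    exact ⟨(isGreatest_lastTime h).1, h.eq⟩
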